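/- Let $0<r<n$, let $A\in\mathbb R^{n\times n}$ be asymptotically stable (all its eigenvalues have negative real part), $B\in\mathbb R^{n\times m}$, $C\in\mathbb R^{p\times n}$, and let $M$ be a square-integrable mean-zero $\mathbb R^m$-valued Lévy process (with càdlàg paths) with $\mathcal Q_M=\mathbb E[M(1)M(1)^T]$. Let $x$ be the càdlàg solution of $dx(t)=Ax(t)\,dt+B\,dM(t)$, $x(0)=0$, and let $y(t)=Cx(t)$. Assume that the Gramians $$P=\int_0^\infty e^{As}B\mathcal Q_MB^Te^{A^Ts}\,ds,\qquad Q=\int_0^\infty e^{A^Ts}C^TCe^{As}\,ds$$ are positive definite. Let $\sigma_1\ge\dots\ge\sigma_n$ be the Hankel singular values, that is, the square roots of the eigenvalues of $PQ$ counted with multiplicity, and assume that $\sigma_r\neq\sigma_{r+1}$. Let $T\in\mathbb R^{n\times n}$ be a balancing transformation: $T$ is nonsingular and $TPT^T=T^{-T}QT^{-1}=\operatorname{diag}(\sigma_1,\dots,\sigma_n)$. Partition $$TAT^{-1}=\begin{pmatrix}A_{11}&A_{12}\\A_{21}&A_{22}\end{pmatrix},\qquad TB=\begin{pmatrix}B_1\\B_2\end{pmatrix},\qquad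 CT^{-1}=\begin{pmatrix}C_1&C_2\end{pmatrix},$$ where $A_{11}\in\mathbb R^{r\times r}$, $B_1\in\mathbb R^{r\times m}$, $C_1\in\mathbb R^{p\times r}$, and put $\Sigma_2=\operatorname{diag}(\sigma_{r+1},\dots,\sigma_n)$. Let $x_r$ be the càdlàg solution of the balanced-truncation reduced system $dx_r(t)=A_{11}x_r(t)\,dt+B_1\,dM(t)$, $x_r(0)=0$, and let $y_{BT}(t)=C_1x_r(t)$. Let $P_g\in\mathbb R^{n\times r}$ solve $AP_g+P_gA_{11}^T=-B\mathcal Q_MB_1^T$, and let $P_{g,2}$ consist of the last $n-r$ rows of $TP_g$. Then, for every final time $t_{\max}\ge 0$, the error $y(t)-y_{BT}(t)$ is integrable for all $t\in[0,t_{\max}]$, the trace below is nonnegative, and $$\sup_{t\in[0,t_{\max}]}\mathbb E\,\|y(t)-y_{BT}(t)\|_{\mathbb R^p}\le\Bigl(\operatorname{tr}\bigl(\Sigma_2(B_2\mathcal Q_MB_2^T+2P_{g,2}A_{21}^T)\bigr)\Bigr)^{1/2},$$ where $\|\cdot\|_{\mathbb R^p}$ is the Euclidean norm. -/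

import Mathlib

open MeasureTheory ProbabilityTheory Filter Topology Set
open scoped NNReal ENNReal Matrix

namespace LevyBT

noncomputable section

/-- A path on `[0, ∞)` is càdlàg: right continuous with left limits
(the left-limit clause is void at time `0`). -/
def IsCadlag {E : Type*} [TopologicalSpace E] (f : ℝ≥0 → E) : Prop :=
  ∀ t : ℝ≥0, ContinuousWithinAt f (Ici t) t ∧ ∃ l : E, Tendsto f (𝓝[<] t) (𝓝 l)

/-- An `ℝᵐ`-valued Lévy process on `(Ω, μ)`. -/
structure IsLevyProcess {Ω : Type*} [MeasurableSpace Ω] {m : ℕ}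
    (M : ℝ≥0 → Ω → Fin m → ℝ) (μ : Measure Ω) : Prop where
  aemeasurable : ∀ t, AEMeasurable (M t) μ
  start_zero : ∀ᵐ ω ∂μ, M 0 ω = 0
  indep_increments : HasIndepIncrements M μ
  stationary_increments :
    ∀ s h : ℝ≥0, IdentDistrib (fun ω => M (s + h) ω - M s ω) (M h) μ μ
  stochastically_continuous : ∀ t, TendstoInMeasure μ M (𝓝 t) (M t)
  cadlag : ∀ᵐ ω ∂μ, IsCadlag (fun t => M t ω)

/-- A square-integrable Lévy process with mean zero. -/
structure IsSqIntegrableCenteredLevy {Ω : Type*} [MeasurableSpace Ω] {m : ℕ}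
    (M : ℝ≥0 → Ω → Fin m → ℝ) (μ : Measure Ω) : Prop extends IsLevyProcess M μ where
  memLp_two : ∀ t, MemLp (M t) 2 μ
  mean_zero : ∀ t, ∫ ω, M t ω ∂μ = 0

/-- The covariance matrix `𝓠_M = 𝔼[M(1) M(1)ᵀ]`. -/
def covMatrix {Ω : Type*} [MeasurableSpace Ω] {m : ℕ}
    (M : ℝ≥0 → Ω → Fin m → ℝ) (μ : Measure Ω) : Matrix (Fin m) (Fin m) ℝ :=
  Matrix.of fun i j => ∫ ω, M 1 ω i * M 1 ω j ∂μ

/-- The process `x` solves `dx(t) = A x(t) dt + B dM(t)`, `x(0) = 0`.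
The noise enters additively with a constant coefficient and `M(0) = 0`, so that
`∫₀ᵗ B dM(s) = B M(t)` and the integrated equation is a pathwise one. -/
structure IsSolution {Ω : Type*} [MeasurableSpace Ω] {n m : ℕ}
    (A : Matrix (Fin n) (Fin n) ℝ) (B : Matrix (Fin n) (Fin m) ℝ)
    (M : ℝ≥0 → Ω → Fin m → ℝ) (μ : Measure Ω) (x : ℝ≥0 → Ω → Fin n → ℝ) : Prop where
  aemeasurable : ∀ t, AEMeasurable (x t) μ
  cadlag : ∀ᵐ ω ∂μ, IsCadlag (fun t => x t ω)
  equation : ∀ᵐ ω ∂μ, ∀ t : ℝ≥0,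
    x t ω = (∫ s in (0 : ℝ)..(t : ℝ), A *ᵥ x s.toNNReal ω) + B *ᵥ M t ω

/-- The output `C x(t)`, as a vector of `ℝᵖ` with the Euclidean norm. -/
def output {Ω : Type*} {n p : ℕ} (C : Matrix (Fin p) (Fin n) ℝ)
    (x : ℝ≥0 → Ω → Fin n → ℝ) (t : ℝ≥0) (ω : Ω) : EuclideanSpace ℝ (Fin p) :=
  WithLp.toLp 2 (C *ᵥ x t ω)

/-- `A` is asymptotically stable: all its complex eigenvalues have negative real part. -/
def IsAsympStable {n : ℕ} (A : Matrix (Fin n) (Fin n) ℝ) : Prop :=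
  ∀ z ∈ spectrum ℂ (A.map (fun a : ℝ => (a : ℂ))), z.re < 0

/-- `P = ∫₀^∞ exp(A s) B 𝓠 Bᵀ exp(Aᵀ s) ds`, integrated entry by entry. -/
def reachabilityGramian {n m : ℕ} (A : Matrix (Fin n) (Fin n) ℝ)
    (B : Matrix (Fin n) (Fin m) ℝ) (QM : Matrix (Fin m) (Fin m) ℝ) :
    Matrix (Fin n) (Fin n) ℝ :=
  Matrix.of fun i j => ∫ s in Ioi (0 : ℝ),
    (NormedSpace.exp (s • A) * (B * QM * Bᵀ) * NormedSpace.exp (s • Aᵀ)) i j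

/-- `Q = ∫₀^∞ exp(Aᵀ s) Cᵀ C exp(A s) ds`, integrated entry by entry. -/
def observabilityGramian {n p : ℕ} (A : Matrix (Fin n) (Fin n) ℝ)
    (C : Matrix (Fin p) (Fin n) ℝ) : Matrix (Fin n) (Fin n) ℝ :=
  Matrix.of fun i j => ∫ s in Ioi (0 : ℝ),
    (NormedSpace.exp (s • Aᵀ) * (Cᵀ * C) * NormedSpace.exp (s • A)) i j

/-- `σ` lists the Hankel singular values `√λᵢ(P Q)`, with multiplicity, in decreasing order. -/
structure IsHankelSingularValues {n : ℕ} (P Q : Matrix (Fin n) (Fin n) ℝ)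
    (σ : Fin n → ℝ) : Prop where
  antitone : Antitone σ
  nonneg : ∀ i, 0 ≤ σ i
  charpoly_eq :
    (P * Q).charpoly = ∏ i, (Polynomial.X - Polynomial.C (σ i ^ 2))

/-- `T` is a balancing transformation: it is nonsingular, and the transformed Gramians
`T P Tᵀ` and `T⁻ᵀ Q T⁻¹` are both equal to `Σ = diag(σ)`. -/
structure IsBalancing {n : ℕ} (P Q T : Matrix (Fin n) (Fin n) ℝ) (σ : Fin n → ℝ) :
    Prop where
  nonsingular : IsUnit T.det
  reach : T * P * Tᵀ = Matrix.diagonal σ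
  obs : (T⁻¹)ᵀ * Q * T⁻¹ = Matrix.diagonal σ

/-- The first `r` of the indices `0, …, n - 1`. -/
def head {r n : ℕ} (h : r ≤ n) (i : Fin r) : Fin n := ⟨i, by omega⟩

/-- The last `n - r` of the indices `0, …, n - 1`. -/
def tail {r n : ℕ} (h : r ≤ n) (i : Fin (n - r)) : Fin n := ⟨r + i, by omega⟩

/-- The block `A₁₁` of the balanced realisation `T A T⁻¹`. -/
def blockA11 {r n : ℕ} (h : r ≤ n) (T A : Matrix (Fin n) (Fin n) ℝ) :
    Matrix (Fin r) (Fin r) ℝ :=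
  (T * A * T⁻¹).submatrix (head h) (head h)

/-- The block `A₂₁` of the balanced realisation `T A T⁻¹`. -/
def blockA21 {r n : ℕ} (h : r ≤ n) (T A : Matrix (Fin n) (Fin n) ℝ) :
    Matrix (Fin (n - r)) (Fin r) ℝ :=
  (T * A * T⁻¹).submatrix (tail h) (head h)

/-- The first `r` rows of a matrix; `B₁` for the matrix `T B`. -/
def topRows {r n k : ℕ} (h : r ≤ n) (X : Matrix (Fin n) (Fin k) ℝ) :
    Matrix (Fin r) (Fin k) ℝ :=
  X.submatrix (head h) id

/-- The last `n - r` rows of a matrix; `B₂` for `T B`, and `P_{g,2}` for `T P_g`. -/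
def bottomRows {r n k : ℕ} (h : r ≤ n) (X : Matrix (Fin n) (Fin k) ℝ) :
    Matrix (Fin (n - r)) (Fin k) ℝ :=
  X.submatrix (tail h) id

/-- The block `C₁` of the balanced realisation: the first `r` columns of `C T⁻¹`. -/
def blockC1 {r n p : ℕ} (h : r ≤ n) (T : Matrix (Fin n) (Fin n) ℝ)
    (C : Matrix (Fin p) (Fin n) ℝ) : Matrix (Fin p) (Fin r) ℝ :=
  (C * T⁻¹).submatrix id (head h)

/-- `Σ₂ = diag(σ_{r+1}, …, σ_n)`. -/
def sigma2 {r n : ℕ} (h : r ≤ n) (σ : Fin n → ℝ) : Matrix (Fin (n - r)) (Fin (n - r)) ℝ :=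
  Matrix.diagonal fun i => σ (tail h i)

/-- The square of the error bound, `tr(Σ₂ (B₂ 𝓠_M B₂ᵀ + 2 P_{g,2} A₂₁ᵀ))`. -/
def errorBoundSq {r n m : ℕ} (h : r ≤ n) (A T : Matrix (Fin n) (Fin n) ℝ)
    (B : Matrix (Fin n) (Fin m) ℝ) (QM : Matrix (Fin m) (Fin m) ℝ) (σ : Fin n → ℝ)
    (Pg : Matrix (Fin n) (Fin r) ℝ) : ℝ :=
  (sigma2 h σ *
    (bottomRows h (T * B) * QM * (bottomRows h (T * B))ᵀ
      + (2 : ℝ) • (bottomRows h (T * Pg) * (blockA21 h T A)ᵀ))).trace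

end

end LevyBT

/-!
# The balanced truncation error bound for linear systems with Lévy noise

Each component of the error is a functional `c ⬝ x(t) + c₁ ⬝ x_r(t)`, where `c` is a row of `C` and
`-c₁` a row of `C₁`. If `u` and `v` solve the adjoint equations `u' = Aᵀ u`, `v' = A₁₁ᵀ v` with
initial values `c` and `c₁`, the functional is the Wiener integral `∫₀ᵗ φ(t - s) ⬝ dM(s)` of the
kernel `φ = Bᵀ u + B₁ᵀ v`. The noise being additive, this is a pathwise statement: after integration
by parts it is variation of constants for càdlàg paths (`dotProduct_add_dotProduct_eq`). The
integral is the almost sure limit of weighted sums of increments, whose second moments are Riemann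
sums, so that Fatou's lemma bounds its second moment by `∫₀ᵗ φ ⬝ 𝓠 φ`
(`IsSqIntegrableCenteredLevy.lintegral_convolution_sq_le`).

Let `V(u, v) = u ⬝ P u + 2 u ⬝ P_g v + v ⬝ Σ₁ v`. The Lyapunov equations for `P`, `P_g` and `Σ₁` say
that `φ ⬝ 𝓠 φ` is minus the derivative of `V` along the adjoint flows, so the integral is
`V(c, c₁) - V(u(t), v(t))`, and `V` is nonnegative (`blockQuadratic_nonneg`): it is nonincreasing,
`V ≥ 2 u ⬝ P_g v`, and `u` tends to zero while `v` stays bounded. The equations for `P` and `Q`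
and the decay of `u` come from positive definiteness of the Gramians, which forces their defining
integrals to converge (`lyapunov_of_gramian`, `tendsto_gramian_quadratic`).

Summed over the rows, `V(c, c₁)` is
`tr(C P Cᵀ) - 2 tr(C P_g C₁ᵀ) + tr(C₁ Σ₁ C₁ᵀ)`, which the Lyapunov equations in balanced coordinates
turn into the stated trace (`balanced_trace_identity`). The bound for the first absolute moment
follows by the Cauchy–Schwarz inequality.
-/

namespace LevyBT

/-! ### Càdlàg paths -/

section Cadlag

variable {E : Type*} [NormedAddCommGroup E]

/-- One-sided limits bound a càdlàg function near every point, and compactness does the rest. -/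
lemma IsCadlag.exists_norm_le {f : ℝ≥0 → E} (hf : IsCadlag f) (t : ℝ≥0) :
    ∃ K, ∀ s ≤ t, ‖f s‖ ≤ K := by
  have key : ∃ K, ∀ s ∈ Icc (0 : ℝ≥0) t, ‖f s‖ ≤ K := by
    refine isCompact_Icc.induction_on (p := fun S => ∃ K, ∀ s ∈ S, ‖f s‖ ≤ K)
      ⟨0, by simp⟩ ?_ ?_ ?_
    · rintro S S' hS ⟨K, hK⟩
      exact ⟨K, fun s hs => hK s (hS hs)⟩
    · rintro S S' ⟨K, hK⟩ ⟨K', hK'⟩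
      exact ⟨max K K', fun s hs => hs.elim (fun h => (hK s h).trans (le_max_left _ _))
        (fun h => (hK' s h).trans (le_max_right _ _))⟩
    · intro s _
      obtain ⟨hr, l, hl⟩ := hf s
      have h1 : ∀ᶠ z in 𝓝[≥] s, ‖f z‖ ≤ ‖f s‖ + 1 :=
        (hr.norm.eventually (gt_mem_nhds (lt_add_one _))).mono fun _ h => h.le
      have h2 : ∀ᶠ z in 𝓝[<] s, ‖f z‖ ≤ ‖l‖ + 1 :=
        (hl.norm.eventually (gt_mem_nhds (lt_add_one _))).mono fun _ h => h.le
      have h3 : ∀ᶠ z in 𝓝 s, ‖f z‖ ≤ max (‖f s‖ + 1) (‖l‖ + 1) := by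
        rw [← nhdsLT_sup_nhdsGE, eventually_sup]
        exact ⟨h2.mono fun _ h => h.trans (le_max_right _ _),
          h1.mono fun _ h => h.trans (le_max_left _ _)⟩
      exact ⟨_, mem_nhdsWithin_of_mem_nhds h3, _, fun z hz => hz⟩
  obtain ⟨K, hK⟩ := key
  exact ⟨K, fun s hs => hK s ⟨zero_le, hs⟩⟩

/-- The grid points above `s` converge to `s` from the right. -/
lemma tendsto_ceil_grid {t : ℝ≥0} (ht : t ≠ 0) (s : ℝ≥0) :
    Tendsto (fun N : ℕ => t * ((⌈s / t * ((N : ℝ≥0) + 1)⌉₊ : ℝ≥0) / ((N : ℝ≥0) + 1))) atTop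
      (𝓝[≥] s) := by
  rw [tendsto_nhdsWithin_iff]
  constructor
  · have h1 := (tendsto_nat_ceil_mul_div_atTop (R := ℝ) (a := s / t) (by positivity)).comp
      (tendsto_atTop_add_const_right _ 1 tendsto_natCast_atTop_atTop : Tendsto
        (fun N : ℕ => ((N : ℝ) + 1)) atTop atTop)
    have hceil : ∀ N : ℕ, ⌈(s : ℝ) / t * ((N : ℝ) + 1)⌉₊ = ⌈s / t * ((N : ℝ≥0) + 1)⌉₊ := by
      intro N
      refine eq_of_forall_ge_iff fun k => ?_
      rw [Nat.ceil_le, Nat.ceil_le, ← NNReal.coe_le_coe]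
      push_cast
      rfl
    have h2 : Tendsto (fun N : ℕ =>
        ((⌈s / t * ((N : ℝ≥0) + 1)⌉₊ : ℝ≥0) / ((N : ℝ≥0) + 1))) atTop (𝓝 (s / t)) := by
      rw [← NNReal.tendsto_coe]
      push_cast
      refine h1.congr fun N => ?_
      simp only [Function.comp_apply, hceil]
    have h3 := h2.const_mul t
    rwa [mul_div_cancel₀ _ ht] at h3
  · refine Eventually.of_forall fun N => ?_
    have hN : (0 : ℝ≥0) < (N : ℝ≥0) + 1 := by positivity
    have ht' : 0 < t := pos_iff_ne_zero.2 ht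
    have : s / t ≤ (⌈s / t * ((N : ℝ≥0) + 1)⌉₊ : ℝ≥0) / ((N : ℝ≥0) + 1) := by
      rw [le_div_iff₀ hN]; exact Nat.le_ceil _
    calc s = t * (s / t) := by rw [mul_div_cancel₀ _ ht]
      _ ≤ _ := by gcongr

/-- A càdlàg function is measurable: it is the limit of its samples on finer and finer grids. -/
lemma IsCadlag.measurable [MeasurableSpace E] [BorelSpace E] {f : ℝ≥0 → E} (hf : IsCadlag f) :
    Measurable f := by
  refine measurable_of_tendsto_metrizable (f := fun (N : ℕ) s =>
    f (1 * ((⌈s / 1 * ((N : ℝ≥0) + 1)⌉₊ : ℝ≥0) / ((N : ℝ≥0) + 1)))) (fun N => ?_) ?_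
  · have h1 : Measurable (fun k : ℕ => f (1 * ((k : ℝ≥0) / ((N : ℝ≥0) + 1)))) :=
      measurable_from_top
    exact h1.comp (Nat.measurable_ceil.comp (by fun_prop))
  · rw [tendsto_pi_nhds]
    intro s
    exact (hf s).1.tendsto.comp (tendsto_ceil_grid one_ne_zero s)

lemma IsCadlag.comp_continuous {F : Type*} [TopologicalSpace F] {f : ℝ≥0 → E} (hf : IsCadlag f)
    {g : E → F} (hg : Continuous g) : IsCadlag (fun t => g (f t)) := fun t =>
  ⟨hg.continuousAt.comp_continuousWithinAt (hf t).1, by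
    obtain ⟨l, hl⟩ := (hf t).2
    exact ⟨g l, (hg.tendsto l).comp hl⟩⟩

lemma _root_.Continuous.isCadlag {F : Type*} [TopologicalSpace F] {f : ℝ≥0 → F}
    (hf : Continuous f) : IsCadlag f := fun t =>
  ⟨hf.continuousWithinAt, f t, hf.continuousAt.tendsto.mono_left nhdsWithin_le_nhds⟩

lemma IsCadlag.continuousWithinAt_toNNReal {f : ℝ≥0 → E} (hf : IsCadlag f) (s : ℝ) :
    ContinuousWithinAt (fun z : ℝ => f z.toNNReal) (Ici s) s := by
  have := (hf s.toNNReal).1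
  refine this.comp (f := Real.toNNReal) continuous_real_toNNReal.continuousWithinAt ?_
  intro z hz
  exact Real.toNNReal_le_toNNReal hz

/-- A product of a continuous and a càdlàg function is integrable on bounded intervals. -/
lemma IsCadlag.intervalIntegrable_mul {f : ℝ≥0 → ℝ} (hf : IsCadlag f) {h : ℝ → ℝ}
    (hh : Continuous h) (t : ℝ≥0) :
    IntervalIntegrable (fun s : ℝ => h s * f s.toNNReal) volume 0 t := by
  obtain ⟨K, hK⟩ := hf.exists_norm_le t
  obtain ⟨H, hH⟩ := (isCompact_Icc (a := (0 : ℝ)) (b := t)).exists_bound_of_continuousOn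
    hh.continuousOn
  rw [intervalIntegrable_iff_integrableOn_Ioc_of_le t.coe_nonneg]
  refine Integrable.mono' (g := fun _ => H * K) (integrable_const _)
    (hh.measurable.mul (hf.measurable.comp measurable_real_toNNReal)).aestronglyMeasurable ?_
  refine (ae_restrict_iff' measurableSet_Ioc).2 (Eventually.of_forall fun s hs => ?_)
  have h1 := hH s ⟨hs.1.le, hs.2⟩
  have h2 := hK s.toNNReal (Real.toNNReal_le_iff_le_coe.2 hs.2)
  rw [norm_mul]
  exact mul_le_mul h1 h2 (norm_nonneg _) ((norm_nonneg _).trans h1)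

/-- Right-endpoint Riemann sums of a càdlàg function against a continuous density converge. -/
lemma IsCadlag.tendsto_riemannSum {f : ℝ≥0 → ℝ} (hf : IsCadlag f) {h : ℝ → ℝ}
    (hh : Continuous h) (t : ℝ≥0) :
    Tendsto (fun N : ℕ => ∑ i ∈ Finset.range (N + 1),
      (∫ s in (t * (i / (N + 1)) : ℝ)..(t * ((i + 1 : ℕ) / (N + 1)) : ℝ), h s) *
        f (t * ((i + 1 : ℕ) / ((N : ℝ≥0) + 1)))) atTop
      (𝓝 (∫ s in (0 : ℝ)..t, h s * f s.toNNReal)) := by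
  rcases eq_or_ne t 0 with rfl | ht
  · simp
  have ht' : (0 : ℝ) < t := by exact_mod_cast pos_iff_ne_zero.2 ht
  obtain ⟨K, hK⟩ := hf.exists_norm_le t
  obtain ⟨H, hH⟩ := (isCompact_Icc (a := (0 : ℝ)) (b := t)).exists_bound_of_continuousOn
    hh.continuousOn
  set c : ℕ → ℝ → ℕ := fun N s => ⌈s.toNNReal / t * ((N : ℝ≥0) + 1)⌉₊ with hc
  set F : ℕ → ℝ → ℝ := fun N s => h s * f (t * ((c N s : ℝ≥0) / ((N : ℝ≥0) + 1))) with hF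
  -- on each cell of the grid the sampled integrand is `h` times the right-endpoint value
  have hcell : ∀ N i : ℕ, ∀ s ∈ Ioc (t * (i / (N + 1)) : ℝ) (t * ((i + 1 : ℕ) / (N + 1)) : ℝ),
      F N s = h s * f (t * ((i + 1 : ℕ) / ((N : ℝ≥0) + 1))) := by
    intro N i s hs
    have hN : (0 : ℝ) < (N : ℝ) + 1 := by positivity
    have hs0 : 0 < s := lt_of_le_of_lt (by positivity) hs.1
    have : c N s = i + 1 := by
      rw [hc]
      refine (Nat.ceil_eq_iff (Nat.succ_ne_zero _)).2 ⟨?_, ?_⟩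
      · rw [← NNReal.coe_lt_coe]
        push_cast
        rw [Real.coe_toNNReal _ hs0.le]
        have := hs.1
        have h3 : (t : ℝ) * (i / (N + 1)) = (i : ℝ) * t / (N + 1) := by ring
        rw [h3, div_lt_iff₀ hN] at this
        rw [div_mul_eq_mul_div, lt_div_iff₀ ht']
        simpa using this
      · rw [← NNReal.coe_le_coe]
        push_cast
        rw [Real.coe_toNNReal _ hs0.le]
        have := hs.2
        have h3 : (t : ℝ) * ((i + 1 : ℕ) / (N + 1)) = ((i : ℝ) + 1) * t / (N + 1) := by
          push_cast; ring
        rw [h3, le_div_iff₀ hN] at this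
        rw [div_mul_eq_mul_div, div_le_iff₀ ht']
        exact this
    simp only [hF, this]
  have hle : ∀ N i : ℕ, (t * (i / (N + 1)) : ℝ) ≤ (t * ((i + 1 : ℕ) / (N + 1)) : ℝ) := by
    intro N i
    gcongr
    simp
  have hsum : ∀ N : ℕ, ∑ i ∈ Finset.range (N + 1),
      (∫ s in (t * (i / (N + 1)) : ℝ)..(t * ((i + 1 : ℕ) / (N + 1)) : ℝ), h s) *
        f (t * ((i + 1 : ℕ) / ((N : ℝ≥0) + 1))) = ∫ s in (0 : ℝ)..t, F N s := by
    intro N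
    have hN : (0 : ℝ) < (N : ℝ) + 1 := by positivity
    have := intervalIntegral.sum_integral_adjacent_intervals (f := F N) (μ := volume)
      (a := fun i : ℕ => (t * (i / (N + 1)) : ℝ)) (n := N + 1) (fun i _ => by
        rw [intervalIntegrable_congr (g := fun s => h s * f (t * ((i + 1 : ℕ) / ((N : ℝ≥0) + 1))))]
        · exact (hh.mul continuous_const).intervalIntegrable _ _
        · intro s hs
          rw [uIoc_of_le (hle N i)] at hs
          exact hcell N i s hs)
    have h4 : (t : ℝ) * (((N + 1 : ℕ) : ℝ) / (N + 1)) = t := by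
      push_cast; field_simp
    simp only [h4] at this
    simp only [Nat.cast_zero, zero_div, mul_zero] at this
    rw [← this]
    refine Finset.sum_congr rfl fun i _ => ?_
    rw [← intervalIntegral.integral_mul_const]
    refine intervalIntegral.integral_congr_ae (Eventually.of_forall fun s hs => ?_)
    rw [uIoc_of_le (hle N i)] at hs
    exact (hcell N i s hs).symm
  simp_rw [hsum]
  refine intervalIntegral.tendsto_integral_filter_of_dominated_convergence (fun _ => H * K)
    (Eventually.of_forall fun N => ?_) (Eventually.of_forall fun N => ?_) (by simp) ?_
  · have h1 : Measurable (fun k : ℕ => f (t * ((k : ℝ≥0) / ((N : ℝ≥0) + 1)))) :=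
      measurable_from_top
    have h2 : Measurable (c N) := Nat.measurable_ceil.comp (by fun_prop)
    exact (hh.measurable.mul (h1.comp h2)).aestronglyMeasurable
  · refine Eventually.of_forall fun s hs => ?_
    rw [uIoc_of_le ht'.le] at hs
    have h1 := hH s ⟨hs.1.le, hs.2⟩
    have h2 : ‖f (t * ((c N s : ℝ≥0) / ((N : ℝ≥0) + 1)))‖ ≤ K := by
      apply hK
      have hs2 : s.toNNReal ≤ t := Real.toNNReal_le_iff_le_coe.2 hs.2
      have : c N s ≤ N + 1 := by
        refine Nat.ceil_le.2 ?_
        push_cast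
        refine mul_le_of_le_one_left (by positivity) (div_le_one_of_le₀ hs2 (by positivity))
      have h5 : (c N s : ℝ≥0) ≤ (N : ℝ≥0) + 1 := by exact_mod_cast this
      exact mul_le_of_le_one_right (by positivity) (div_le_one_of_le₀ h5 (by positivity))
    rw [hF, norm_mul]
    exact mul_le_mul h1 h2 (norm_nonneg _) ((norm_nonneg _).trans h1)
  · refine Eventually.of_forall fun s hs => ?_
    exact ((hf s.toNNReal).1.tendsto.comp (tendsto_ceil_grid ht _)).const_mul _

end Cadlag

/-! ### Variation of constants -/

lemma _root_.HasDerivAt.dotProduct {n : ℕ} {u v : ℝ → Fin n → ℝ} {u' v' : Fin n → ℝ} {s : ℝ}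
    (hu : HasDerivAt u u' s) (hv : HasDerivAt v v' s) :
    HasDerivAt (fun z => u z ⬝ᵥ v z) (u' ⬝ᵥ v s + u s ⬝ᵥ v') s := by
  simp only [_root_.dotProduct, ← Finset.sum_add_distrib]
  exact HasDerivAt.fun_sum fun i _ => (hasDerivAt_pi.1 hu i).mul (hasDerivAt_pi.1 hv i)

lemma _root_.HasDerivWithinAt.dotProduct {n : ℕ} {u v : ℝ → Fin n → ℝ} {u' v' : Fin n → ℝ}
    {s : ℝ} {S : Set ℝ} (hu : HasDerivWithinAt u u' S s) (hv : HasDerivWithinAt v v' S s) :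
    HasDerivWithinAt (fun z => u z ⬝ᵥ v z) (u' ⬝ᵥ v s + u s ⬝ᵥ v') S s := by
  simp only [_root_.dotProduct, ← Finset.sum_add_distrib]
  exact HasDerivWithinAt.fun_sum fun i _ =>
    (hasDerivWithinAt_pi.1 hu i).mul (hasDerivWithinAt_pi.1 hv i)

/-- Variation of constants for `x(t) = ∫₀ᵗ A x + g(t)` with càdlàg `x` and `g`, tested against a
solution `u` of the adjoint equation `u' = Aᵀ u`. The derivative of `s ↦ u(t - s) ⬝ (x - g)(s)`
is taken from the right, because `x` and `g` may jump. -/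
lemma dotProduct_eq_of_integral_equation {n : ℕ} {A : Matrix (Fin n) (Fin n) ℝ}
    {x g : ℝ≥0 → Fin n → ℝ} (hx : IsCadlag x) (hg : IsCadlag g)
    (hxg : ∀ t : ℝ≥0, x t = (∫ s in (0 : ℝ)..(t : ℝ), A *ᵥ x s.toNNReal) + g t)
    {u : ℝ → Fin n → ℝ} (hu : ∀ s, HasDerivAt u (Aᵀ *ᵥ u s) s) (t : ℝ≥0) :
    u 0 ⬝ᵥ x t = u 0 ⬝ᵥ g t + ∫ s in (0 : ℝ)..t, (Aᵀ *ᵥ u (t - s)) ⬝ᵥ g s.toNNReal := by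
  have hAx : IsCadlag (fun s => A *ᵥ x s) := hx.comp_continuous (g := fun z => A *ᵥ z) (by fun_prop)
  have hu_cont : Continuous u := continuous_iff_continuousAt.2 fun s => (hu s).continuousAt
  have hmeas : Measurable (fun s : ℝ => A *ᵥ x s.toNNReal) :=
    hAx.measurable.comp measurable_real_toNNReal
  have hint : ∀ b : ℝ≥0, IntervalIntegrable (fun s : ℝ => A *ᵥ x s.toNNReal) volume 0 b := by
    intro b
    obtain ⟨K, hK⟩ := hAx.exists_norm_le b
    rw [intervalIntegrable_iff_integrableOn_Ioc_of_le b.coe_nonneg]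
    refine Integrable.mono' (g := fun _ => K) (integrable_const _) hmeas.aestronglyMeasurable ?_
    refine (ae_restrict_iff' measurableSet_Ioc).2 (Eventually.of_forall fun s hs => ?_)
    exact hK s.toNNReal (Real.toNNReal_le_iff_le_coe.2 hs.2)
  set y : ℝ → Fin n → ℝ := fun b => ∫ s in (0 : ℝ)..b, A *ᵥ x s.toNNReal with hy
  have hy_cont : ContinuousOn y (Icc 0 t) := by
    have := intervalIntegral.continuousOn_primitive_interval' (hint t) (a := 0) (by simp)
    rwa [uIcc_of_le t.coe_nonneg] at this
  have hy_der : ∀ s ∈ Ioo (0 : ℝ) t, HasDerivWithinAt y (A *ᵥ x s.toNNReal) (Ioi s) s := by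
    intro s hs
    have h1 : IntervalIntegrable (fun s : ℝ => A *ᵥ x s.toNNReal) volume 0 s := by
      exact hint ⟨s, hs.1.le⟩
    refine HasDerivWithinAt.mono (t := Ici s) ?_ Ioi_subset_Ici_self
    refine intervalIntegral.integral_hasDerivWithinAt_right h1 (s := Ici s) (t := Ioi s) ?_ ?_
    · exact hmeas.stronglyMeasurable.stronglyMeasurableAtFilter
    · exact (hAx.continuousWithinAt_toNNReal s).mono Ioi_subset_Ici_self
  have hxy : ∀ s : ℝ, 0 ≤ s → x s.toNNReal = y s + g s.toNNReal := by
    intro s hs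
    have := hxg s.toNNReal
    rwa [Real.coe_toNNReal _ hs] at this
  have hder : ∀ s ∈ Ioo (0 : ℝ) t, HasDerivWithinAt (fun z => u (t - z) ⬝ᵥ y z)
      ((Aᵀ *ᵥ u (t - s)) ⬝ᵥ g s.toNNReal) (Ioi s) s := by
    intro s hs
    have h1 : HasDerivAt (fun z : ℝ => u (t - z)) (-(Aᵀ *ᵥ u (t - s))) s := by
      have := (hu (t - s)).scomp s ((hasDerivAt_id s).const_sub (t : ℝ))
      simpa [Function.comp_def] using this
    refine (h1.hasDerivWithinAt.dotProduct (hy_der s hs)).congr_deriv ?_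
    rw [hxy s hs.1.le, Matrix.mulVec_add, dotProduct_add, neg_dotProduct, Matrix.mulVec_transpose,
      ← Matrix.dotProduct_mulVec, ← Matrix.dotProduct_mulVec]
    ring
  have hint2 : IntervalIntegrable (fun s : ℝ => (Aᵀ *ᵥ u (t - s)) ⬝ᵥ g s.toNNReal)
      volume 0 t := by
    simp only [_root_.dotProduct]
    refine (IntervalIntegrable.sum Finset.univ
      (f := fun i s => (Aᵀ *ᵥ u (t - s)) i * g s.toNNReal i) fun i _ => ?_).congr
      (fun s _ => by simp [Finset.sum_apply])
    exact (hg.comp_continuous (continuous_apply i)).intervalIntegrable_mul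
      (h := fun s => (Aᵀ *ᵥ u (t - s)) i) (by fun_prop) t
  have hFTC := intervalIntegral.integral_eq_sub_of_hasDeriv_right
    (f := fun z => u (t - z) ⬝ᵥ y z) (a := 0) (b := t)
    (f' := fun s => (Aᵀ *ᵥ u (t - s)) ⬝ᵥ g s.toNNReal) (by
      rw [uIcc_of_le t.coe_nonneg]
      simp only [_root_.dotProduct]
      refine continuousOn_finsetSum _ fun i _ => ContinuousOn.mul ?_ ?_
      · exact Continuous.continuousOn (by fun_prop)
      · exact (continuous_apply i).comp_continuousOn hy_cont) (by
      rwa [min_eq_left t.coe_nonneg, max_eq_right t.coe_nonneg]) hint2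
  rw [hFTC]
  have hy0 : y 0 = 0 := by simp [hy]
  simp only [sub_self, hy0, dotProduct_zero, sub_zero]
  rw [hxg t, dotProduct_add]
  ring

/-! ### Second moments of weighted increments -/

section Levy

variable {Ω : Type*} [MeasurableSpace Ω] {μ : Measure Ω} {m : ℕ} {M : ℝ≥0 → Ω → Fin m → ℝ}

lemma IsSqIntegrableCenteredLevy.memLp_dotProduct (hM : IsSqIntegrableCenteredLevy M μ)
    (v : Fin m → ℝ) (t : ℝ≥0) : MemLp (fun ω => v ⬝ᵥ M t ω) 2 μ := by
  simp only [dotProduct]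
  exact memLp_finsetSum _ fun i _ => ((memLp_pi_iff.1 (hM.memLp_two t)) i).const_mul (v i)

lemma covMatrix_transpose : (covMatrix M μ)ᵀ = covMatrix M μ := by
  ext i j
  simp only [covMatrix, Matrix.transpose_apply, Matrix.of_apply, mul_comm]

lemma measurable_dotProduct_left (v : Fin m → ℝ) : Measurable fun z : Fin m → ℝ => v ⬝ᵥ z := by
  simp only [dotProduct]
  fun_prop

lemma IsLevyProcess.variance_increment (hM : IsLevyProcess M μ) (v : Fin m → ℝ) (s h : ℝ≥0) :
    Var[fun ω => v ⬝ᵥ (M (s + h) ω - M s ω); μ] = Var[fun ω => v ⬝ᵥ M h ω; μ] :=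
  ((hM.stationary_increments s h).comp (measurable_dotProduct_left v)).variance_eq

lemma IsSqIntegrableCenteredLevy.memLp_increment (hM : IsSqIntegrableCenteredLevy M μ)
    (v : Fin m → ℝ) (s t : ℝ≥0) : MemLp (fun ω => v ⬝ᵥ (M t ω - M s ω)) 2 μ := by
  simp only [dotProduct_sub]
  exact (hM.memLp_dotProduct v t).sub (hM.memLp_dotProduct v s)

/-- `v ⬝ M(s + h)` is the sum of the independent `v ⬝ M(s)` and an increment distributed as
`v ⬝ M(h)`. -/
lemma IsSqIntegrableCenteredLevy.variance_add (hM : IsSqIntegrableCenteredLevy M μ)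
    (v : Fin m → ℝ) (s h : ℝ≥0) :
    Var[fun ω => v ⬝ᵥ M (s + h) ω; μ]
      = Var[fun ω => v ⬝ᵥ M s ω; μ] + Var[fun ω => v ⬝ᵥ M h ω; μ] := by
  have hind : (fun ω => v ⬝ᵥ M s ω) ⟂ᵢ[μ] (fun ω => v ⬝ᵥ (M (s + h) ω - M s ω)) :=
    (hM.indep_increments.indepFun_eval_sub (zero_le (a := s)) (le_self_add (a := s) (b := h))
      hM.start_zero).comp (measurable_dotProduct_left v) (measurable_dotProduct_left v)
  have := hind.variance_add (hM.memLp_dotProduct v s) (hM.memLp_increment v s (s + h))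
  rw [hM.variance_increment v s h] at this
  rw [← this]
  congr 1
  ext ω
  simp [dotProduct_sub]

variable [IsProbabilityMeasure μ]

lemma IsSqIntegrableCenteredLevy.integral_dotProduct (hM : IsSqIntegrableCenteredLevy M μ)
    (v : Fin m → ℝ) (t : ℝ≥0) : ∫ ω, v ⬝ᵥ M t ω ∂μ = 0 := by
  have hi : ∀ i, Integrable (fun ω => M t ω i) μ := fun i =>
    ((memLp_pi_iff.1 (hM.memLp_two t)) i).integrable (by norm_num)
  simp only [dotProduct]
  rw [integral_finsetSum _ fun i _ => (hi i).const_mul (v i)]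
  refine Finset.sum_eq_zero fun i _ => ?_
  rw [integral_const_mul, ← eval_integral hi, hM.mean_zero t, Pi.zero_apply, mul_zero]

lemma IsSqIntegrableCenteredLevy.variance_dotProduct_one (hM : IsSqIntegrableCenteredLevy M μ)
    (v : Fin m → ℝ) :
    Var[fun ω => v ⬝ᵥ M 1 ω; μ] = v ⬝ᵥ (covMatrix M μ *ᵥ v) := by
  have hi : ∀ i, MemLp (fun ω => M 1 ω i) 2 μ := fun i => (memLp_pi_iff.1 (hM.memLp_two 1)) i
  rw [variance_of_integral_eq_zero (hM.memLp_dotProduct v 1).aemeasurable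
    (hM.integral_dotProduct v 1)]
  have h1 : ∀ ω, (v ⬝ᵥ M 1 ω) ^ 2 = ∑ i, ∑ j, v i * v j * (M 1 ω i * M 1 ω j) := by
    intro ω
    rw [sq, dotProduct, Finset.sum_mul_sum]
    exact Finset.sum_congr rfl fun i _ => Finset.sum_congr rfl fun j _ => by ring
  have hij : ∀ i j, Integrable (fun ω => v i * v j * (M 1 ω i * M 1 ω j)) μ := fun i j =>
    ((hi i).integrable_mul (hi j)).const_mul _
  simp only [h1]
  rw [integral_finsetSum _ fun i _ => integrable_finsetSum _ fun j _ => hij i j]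
  simp only [dotProduct, Matrix.mulVec, Finset.mul_sum]
  refine Finset.sum_congr rfl fun i _ => ?_
  rw [integral_finsetSum _ fun j _ => hij i j]
  refine Finset.sum_congr rfl fun j _ => ?_
  rw [integral_const_mul, covMatrix, Matrix.of_apply]
  ring

lemma IsSqIntegrableCenteredLevy.covMatrix_quadratic_nonneg (hM : IsSqIntegrableCenteredLevy M μ)
    (v : Fin m → ℝ) : 0 ≤ v ⬝ᵥ (covMatrix M μ *ᵥ v) :=
  hM.variance_dotProduct_one v ▸ variance_nonneg _ _

/-- The variance of `v ⬝ M(h)` grows at most linearly in `h`. It is additive and nonnegative, hence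
monotone, and comparing `h` with the multiples of `1 / N` gives the bound. -/
lemma IsSqIntegrableCenteredLevy.variance_le (hM : IsSqIntegrableCenteredLevy M μ)
    (v : Fin m → ℝ) (h : ℝ≥0) :
    Var[fun ω => v ⬝ᵥ M h ω; μ] ≤ h * (v ⬝ᵥ (covMatrix M μ *ᵥ v)) := by
  set f : ℝ≥0 → ℝ := fun t => Var[fun ω => v ⬝ᵥ M t ω; μ] with hf
  set q := v ⬝ᵥ (covMatrix M μ *ᵥ v) with hq
  have hadd : ∀ s t, f (s + t) = f s + f t := hM.variance_add v
  have hnn : ∀ s, 0 ≤ f s := fun s => variance_nonneg _ _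
  have hmono : Monotone f := by
    intro s t hst
    obtain ⟨c, rfl⟩ := exists_add_of_le hst
    rw [hadd]
    linarith [hnn c]
  have hmul : ∀ (k : ℕ) (s : ℝ≥0), f (k * s) = k * f s := by
    intro k s
    induction k with
    | zero =>
      have := hadd 0 0
      simp only [add_zero] at this
      simp only [Nat.cast_zero, zero_mul]
      linarith
    | succ k ih => push_cast; rw [add_mul, one_mul, hadd, ih]; ring
  have hbound : ∀ N : ℕ, f h ≤ (h + 1 / ((N : ℝ) + 1)) * q := by
    intro N
    have hN : (0 : ℝ≥0) < (N : ℝ≥0) + 1 := by positivity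
    have h1 : f 1 = ((N : ℝ) + 1) * f (1 / ((N : ℝ≥0) + 1)) := by
      have := hmul (N + 1) (1 / ((N : ℝ≥0) + 1))
      push_cast at this
      rwa [mul_one_div_cancel hN.ne'] at this
    have hfq : f 1 = q := hM.variance_dotProduct_one v
    have hqnn : 0 ≤ q := hM.covMatrix_quadratic_nonneg v
    have h2 : h ≤ (⌈h * ((N : ℝ≥0) + 1)⌉₊ : ℝ≥0) * (1 / ((N : ℝ≥0) + 1)) := by
      rw [mul_one_div, le_div_iff₀ hN]
      exact Nat.le_ceil _
    have h3 : ((⌈h * ((N : ℝ≥0) + 1)⌉₊ : ℝ≥0) : ℝ) ≤ h * ((N : ℝ) + 1) + 1 := by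
      have := (Nat.ceil_lt_add_one (a := h * ((N : ℝ≥0) + 1)) zero_le).le
      exact_mod_cast this
    have hNr : (0 : ℝ) < (N : ℝ) + 1 := by positivity
    have h4 : f (1 / ((N : ℝ≥0) + 1)) = q / ((N : ℝ) + 1) := by
      rw [eq_div_iff hNr.ne', ← hfq, h1]; ring
    calc f h ≤ _ := hmono h2
      _ = (⌈h * ((N : ℝ≥0) + 1)⌉₊ : ℝ) * (q / ((N : ℝ) + 1)) := by rw [hmul, h4]
      _ ≤ (h * ((N : ℝ) + 1) + 1) * (q / ((N : ℝ) + 1)) := by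
          gcongr
          exact_mod_cast h3
      _ = _ := by field_simp
  have hlim : Tendsto (fun N : ℕ => ((h : ℝ) + 1 / ((N : ℝ) + 1)) * q) atTop
      (𝓝 (((h : ℝ) + 0) * q)) :=
    (tendsto_const_nhds.add tendsto_one_div_add_atTop_nhds_zero_nat).mul_const _
  rw [add_zero] at hlim
  exact ge_of_tendsto' hlim hbound

/-- The discrete Itô isometry, as an inequality. -/
lemma IsSqIntegrableCenteredLevy.lintegral_sum_increments_le
    (hM : IsSqIntegrableCenteredLevy M μ) (w : ℕ → Fin m → ℝ) {τ : ℕ → ℝ≥0} (hτ : Monotone τ)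
    (N : ℕ) :
    ∫⁻ ω, ENNReal.ofReal
        ((∑ i ∈ Finset.range N, w i ⬝ᵥ (M (τ (i + 1)) ω - M (τ i) ω)) ^ 2) ∂μ
      ≤ ENNReal.ofReal (∑ i ∈ Finset.range N,
          ((τ (i + 1) : ℝ) - τ i) * (w i ⬝ᵥ (covMatrix M μ *ᵥ w i))) := by
  set X : ℕ → Ω → ℝ := fun i ω => w i ⬝ᵥ (M (τ (i + 1)) ω - M (τ i) ω) with hX
  have hLp : ∀ i, MemLp (X i) 2 μ := fun i => hM.memLp_increment _ _ _
  have hmean : ∀ i, ∫ ω, X i ω ∂μ = 0 := by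
    intro i
    simp only [hX, dotProduct_sub]
    rw [integral_sub ((hM.memLp_dotProduct _ _).integrable (by norm_num))
      ((hM.memLp_dotProduct _ _).integrable (by norm_num)), hM.integral_dotProduct,
      hM.integral_dotProduct, sub_zero]
  have hind : iIndepFun X μ :=
    (hM.indep_increments.nat hτ).comp (fun i z => w i ⬝ᵥ z)
      (fun i => measurable_dotProduct_left (w i))
  have hvar := IndepFun.variance_sum (s := Finset.range N) (fun i _ => hLp i)
    (fun i _ j _ hij => hind.indepFun hij)
  have hSLp : MemLp (fun ω => ∑ i ∈ Finset.range N, X i ω) 2 μ :=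
    memLp_finsetSum _ fun i _ => hLp i
  rw [← ofReal_integral_eq_lintegral_ofReal hSLp.integrable_sq
    (Eventually.of_forall fun ω => sq_nonneg _)]
  refine ENNReal.ofReal_le_ofReal ?_
  have h0 : ∫ ω, ∑ i ∈ Finset.range N, X i ω ∂μ = 0 := by
    rw [integral_finsetSum _ fun i _ => (hLp i).integrable (by norm_num)]
    exact Finset.sum_eq_zero fun i _ => hmean i
  rw [← variance_of_integral_eq_zero hSLp.aemeasurable h0]
  have h1 : (fun ω => ∑ i ∈ Finset.range N, X i ω) = ∑ i ∈ Finset.range N, X i := by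
    ext ω; simp
  rw [h1, hvar]
  refine Finset.sum_le_sum fun i _ => ?_
  obtain ⟨c, hc⟩ := exists_add_of_le (hτ (Nat.le_succ i))
  have h2 := hM.variance_increment (w i) (τ i) c
  rw [← hc] at h2
  have h3 : (c : ℝ) = (τ (i + 1) : ℝ) - τ i := by rw [← Nat.succ_eq_add_one, hc]; simp
  rw [← h3]
  exact h2.trans_le (hM.variance_le (w i) c)

/-- Second-moment bound for the Wiener integral `∫₀ᵗ φ(t - s) ⬝ dM(s)` of a `C¹` kernel, written
without stochastic integration by integrating by parts. The integral is the almost sure limit of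
the sums `∑ φ(t - tᵢ) ⬝ (M(tᵢ₊₁) - M(tᵢ))`, so Fatou's lemma applies. -/
lemma IsSqIntegrableCenteredLevy.lintegral_convolution_sq_le
    (hM : IsSqIntegrableCenteredLevy M μ) {φ φ' : ℝ → Fin m → ℝ}
    (hφ : ∀ s, HasDerivAt φ (φ' s) s) (hφ' : Continuous φ') (t : ℝ≥0) :
    ∫⁻ ω, ENNReal.ofReal ((φ 0 ⬝ᵥ M t ω
        + ∫ s in (0 : ℝ)..t, φ' (t - s) ⬝ᵥ M s.toNNReal ω) ^ 2) ∂μ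
      ≤ ENNReal.ofReal (∫ s in (0 : ℝ)..t, φ s ⬝ᵥ (covMatrix M μ *ᵥ φ s)) := by
  have hφc : Continuous φ := continuous_iff_continuousAt.2 fun s => (hφ s).continuousAt
  set τ : ℕ → ℕ → ℝ≥0 := fun N i => t * ((i : ℝ≥0) / ((N : ℝ≥0) + 1)) with hτ
  have hτr : ∀ N i, ((τ N i : ℝ≥0) : ℝ) = (t * (i / (N + 1)) : ℝ) := by
    intro N i; simp [hτ]
  have hτm : ∀ N, Monotone (τ N) := by
    intro N i j hij
    simp only [hτ]
    gcongr
  have hτlast : ∀ N, τ N (N + 1) = t := by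
    intro N
    simp only [hτ]
    push_cast
    rw [div_self (by positivity), mul_one]
  have hτ0 : ∀ N, τ N 0 = 0 := by intro N; simp [hτ]
  set S : ℕ → Ω → ℝ := fun N ω => ∑ i ∈ Finset.range (N + 1),
    φ (t - τ N i) ⬝ᵥ (M (τ N (i + 1)) ω - M (τ N i) ω) with hS
  -- almost sure convergence of the sums, by summation by parts
  have hconv : ∀ᵐ ω ∂μ, Tendsto (fun N => S N ω) atTop (𝓝 (φ 0 ⬝ᵥ M t ω
      + ∫ s in (0 : ℝ)..t, φ' (t - s) ⬝ᵥ M s.toNNReal ω)) := by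
    filter_upwards [hM.cadlag, hM.start_zero] with ω hω hω0
    have hk : ∀ k, IsCadlag (fun s => M s ω k) := fun k =>
      hω.comp_continuous (continuous_apply k)
    have hcont : ∀ k, Continuous (fun s : ℝ => φ' (t - s) k) := fun k => by fun_prop
    have hint : ∫ s in (0 : ℝ)..t, φ' (t - s) ⬝ᵥ M s.toNNReal ω
        = ∑ k, ∫ s in (0 : ℝ)..t, φ' (t - s) k * M s.toNNReal ω k := by
      simp only [dotProduct]
      exact intervalIntegral.integral_finsetSum fun k _ =>
        (hk k).intervalIntegrable_mul (hcont k) t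
    rw [hint]
    have hlim := tendsto_finsetSum Finset.univ fun k _ =>
      (hk k).tendsto_riemannSum (hcont k) t
    refine (hlim.const_add (φ 0 ⬝ᵥ M t ω)).congr fun N => ?_
    have hcell : ∀ (k : Fin m) (i : ℕ), (∫ s in (t * (i / (N + 1)) : ℝ)..(t * ((i + 1 : ℕ) / (N + 1)) : ℝ),
        φ' (t - s) k) = φ (t - τ N i) k - φ (t - τ N (i + 1)) k := by
      intro k i
      have hd : ∀ s : ℝ, HasDerivAt (fun s : ℝ => -(φ (t - s) k)) (φ' (t - s) k) s := by
        intro s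
        have := ((hasDerivAt_pi.1 (hφ (t - s)) k).scomp s
          ((hasDerivAt_id s).const_sub (t : ℝ))).neg
        exact this.congr_deriv (by simp)
      rw [intervalIntegral.integral_eq_sub_of_hasDerivAt (fun s _ => hd s)
        ((hcont k).intervalIntegrable _ _), hτr, hτr]
      ring
    simp only [hcell]
    rw [Finset.sum_comm]
    have htel := Finset.sum_range_sub (fun i => φ (t - τ N i) ⬝ᵥ M (τ N i) ω) (N + 1)
    rw [hτlast, hτ0, hω0, dotProduct_zero, sub_zero, sub_self] at htel
    rw [← htel, ← Finset.sum_add_distrib]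
    refine Finset.sum_congr rfl fun i _ => ?_
    have : ∑ k, (φ (t - τ N i) k - φ (t - τ N (i + 1)) k) *
        M (t * ((i + 1 : ℕ) / ((N : ℝ≥0) + 1))) ω k
        = (φ (t - τ N i) - φ (t - τ N (i + 1))) ⬝ᵥ M (τ N (i + 1)) ω := by
      simp [dotProduct, hτ]
    rw [this, sub_dotProduct, dotProduct_sub]
    ring
  -- the second moments of the sums are Riemann sums
  have hq : Continuous fun s : ℝ => φ s ⬝ᵥ (covMatrix M μ *ᵥ φ s) := by
    simp only [dotProduct, Matrix.mulVec]
    fun_prop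
  have hR : Tendsto (fun N => ∑ i ∈ Finset.range (N + 1), ((τ N (i + 1) : ℝ) - τ N i) *
      (φ (t - τ N i) ⬝ᵥ (covMatrix M μ *ᵥ φ (t - τ N i)))) atTop
      (𝓝 (∫ s in (0 : ℝ)..t, φ s ⬝ᵥ (covMatrix M μ *ᵥ φ s))) := by
    have h1 := (hq.comp NNReal.continuous_coe).isCadlag.tendsto_riemannSum
      (h := fun _ => 1) continuous_const t
    have h2 : ∫ s in (0 : ℝ)..t, (1 : ℝ) * ((fun s : ℝ => φ s ⬝ᵥ (covMatrix M μ *ᵥ φ s)) ∘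
        ((↑) : ℝ≥0 → ℝ)) s.toNNReal = ∫ s in (0 : ℝ)..t, φ s ⬝ᵥ (covMatrix M μ *ᵥ φ s) := by
      refine intervalIntegral.integral_congr fun s hs => ?_
      rw [uIcc_of_le t.coe_nonneg] at hs
      simp [Real.coe_toNNReal _ hs.1]
    rw [h2] at h1
    refine h1.congr fun N => ?_
    rw [← Finset.sum_range_reflect]
    refine Finset.sum_congr rfl fun i hi => ?_
    have hi' : i ≤ N := Nat.lt_succ_iff.1 (Finset.mem_range.1 hi)
    have hNr : (0 : ℝ) < (N : ℝ) + 1 := by positivity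
    have h3 : (t : ℝ) - τ N i = t * (((N + 1 - 1 - i + 1 : ℕ) : ℝ) / (N + 1)) := by
      rw [hτr, show N + 1 - 1 - i + 1 = N + 1 - i by omega, Nat.cast_sub (by omega)]
      push_cast
      field_simp
    have h4 : ((t * (((N + 1 - 1 - i + 1 : ℕ) : ℝ≥0) / ((N : ℝ≥0) + 1)) : ℝ≥0) : ℝ)
        = t - τ N i := by
      rw [h3]
      simp only [NNReal.coe_mul, NNReal.coe_div, NNReal.coe_natCast, NNReal.coe_add,
        NNReal.coe_one]
    simp only [Function.comp_apply, intervalIntegral.integral_const, smul_eq_mul, mul_one]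
    rw [h4, hτr, hτr, Nat.cast_succ, Nat.cast_succ]
    congr 1
    ring
  calc ∫⁻ ω, ENNReal.ofReal ((φ 0 ⬝ᵥ M t ω
        + ∫ s in (0 : ℝ)..t, φ' (t - s) ⬝ᵥ M s.toNNReal ω) ^ 2) ∂μ
      = ∫⁻ ω, liminf (fun N => ENNReal.ofReal ((S N ω) ^ 2)) atTop ∂μ := by
        refine lintegral_congr_ae ?_
        filter_upwards [hconv] with ω hω
        exact ((ENNReal.continuous_ofReal.tendsto _).comp (hω.pow 2)).liminf_eq.symm
    _ ≤ liminf (fun N => ∫⁻ ω, ENNReal.ofReal ((S N ω) ^ 2) ∂μ) atTop := by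
        refine lintegral_liminf_le' fun N => ?_
        refine AEMeasurable.ennreal_ofReal (AEMeasurable.pow_const ?_ 2)
        exact Finset.aemeasurable_fun_sum _ fun i _ =>
          (hM.memLp_increment _ _ _).aemeasurable
    _ ≤ liminf (fun N => ENNReal.ofReal (∑ i ∈ Finset.range (N + 1),
          ((τ N (i + 1) : ℝ) - τ N i) *
            (φ (t - τ N i) ⬝ᵥ (covMatrix M μ *ᵥ φ (t - τ N i))))) atTop :=
        liminf_le_liminf (Eventually.of_forall fun N =>
          hM.lintegral_sum_increments_le (fun i => φ (t - τ N i)) (hτm N) (N + 1))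
    _ = _ := ((ENNReal.continuous_ofReal.tendsto _).comp hR).liminf_eq

end Levy

/-! ### Gramians and Lyapunov equations -/

section Gramian

open scoped Matrix.Norms.Operator

variable {n : ℕ}

lemma hasDerivAt_matrix_apply {k : ℕ} {F : ℝ → Matrix (Fin n) (Fin k) ℝ}
    {F' : Matrix (Fin n) (Fin k) ℝ} {s : ℝ} (hF : HasDerivAt F F' s) (i : Fin n) (j : Fin k) :
    HasDerivAt (fun z => F z i j) (F' i j) s :=
  ((Matrix.entryLinearMap ℝ ℝ i j).toContinuousLinearMap.hasFDerivAt.comp_hasDerivAt s hF)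

lemma hasDerivAt_exp_smul_mulVec (A : Matrix (Fin n) (Fin n) ℝ) (c : Fin n → ℝ) (s : ℝ) :
    HasDerivAt (fun z : ℝ => NormedSpace.exp (z • A) *ᵥ c)
      (A *ᵥ (NormedSpace.exp (s • A) *ᵥ c)) s := by
  rw [hasDerivAt_pi]
  intro i
  have h := hasDerivAt_exp_smul_const' (𝕂 := ℝ) A s
  rw [Matrix.mulVec_mulVec]
  simp only [Matrix.mulVec, dotProduct]
  exact HasDerivAt.fun_sum fun j _ => (hasDerivAt_matrix_apply h i j).mul_const _

lemma hasDerivAt_exp_mul_exp (A X : Matrix (Fin n) (Fin n) ℝ) (s : ℝ) :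
    HasDerivAt (fun z : ℝ => NormedSpace.exp (z • A) * X * NormedSpace.exp (z • Aᵀ))
      (NormedSpace.exp (s • A) * (A * X + X * Aᵀ) * NormedSpace.exp (s • Aᵀ)) s := by
  have h1 := hasDerivAt_exp_smul_const (𝕂 := ℝ) A s
  have h2 := hasDerivAt_exp_smul_const' (𝕂 := ℝ) Aᵀ s
  refine ((h1.mul_const X).mul h2).congr_deriv ?_
  noncomm_ring

lemma hasDerivAt_exp_mul_exp' (A X : Matrix (Fin n) (Fin n) ℝ) (s : ℝ) :
    HasDerivAt (fun z : ℝ => NormedSpace.exp (z • A) * X * NormedSpace.exp (z • Aᵀ))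
      (A * (NormedSpace.exp (s • A) * X * NormedSpace.exp (s • Aᵀ))
        + NormedSpace.exp (s • A) * X * NormedSpace.exp (s • Aᵀ) * Aᵀ) s := by
  have h1 := hasDerivAt_exp_smul_const' (𝕂 := ℝ) A s
  have h2 := hasDerivAt_exp_smul_const (𝕂 := ℝ) Aᵀ s
  refine ((h1.mul_const X).mul h2).congr_deriv ?_
  noncomm_ring

/-- Nonnegativity of the quadratic form at `eᵢ ± eⱼ` bounds the off-diagonal entries. -/
lemma _root_.Matrix.PosSemidef.abs_apply_le {X : Matrix (Fin n) (Fin n) ℝ} (hX : X.PosSemidef)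
    (i j : Fin n) : |X i j| ≤ X i i + X j j := by
  have key : ∀ a : ℝ, 0 ≤ X i i + a * X i j + a * X j i + a ^ 2 * X j j := by
    intro a
    have := hX.dotProduct_mulVec_nonneg (Pi.single i 1 + a • Pi.single j 1)
    simp only [star_trivial, Matrix.mulVec_add, Matrix.mulVec_smul, add_dotProduct,
      dotProduct_add, smul_dotProduct, dotProduct_smul, Matrix.mulVec_single_one,
      single_one_dotProduct, Matrix.col_apply, smul_eq_mul] at this
    linarith
  have hsymm : X j i = X i j := by simpa using hX.isHermitian.apply i j
  have h1 := key 1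
  have h2 := key (-1)
  have h3 := key 0
  have h4 : 0 ≤ X j j := hX.diag_nonneg
  rw [hsymm] at h1 h2
  rw [abs_le]
  constructor <;> nlinarith

variable {A W P : Matrix (Fin n) (Fin n) ℝ}

/-- If the Gramian has positive diagonal, its defining integrals converge: a divergent diagonal
integral would have the value `0`, and the diagonal entries dominate the others. -/
lemma integrableOn_gramian (hW : W.PosSemidef)
    (hP : ∀ i j, P i j = ∫ s in Ioi (0 : ℝ),
      (NormedSpace.exp (s • A) * W * NormedSpace.exp (s • Aᵀ)) i j)
    (hpos : P.PosDef) (i j : Fin n) :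
    IntegrableOn (fun s : ℝ => (NormedSpace.exp (s • A) * W * NormedSpace.exp (s • Aᵀ)) i j)
      (Ioi 0) := by
  have hdiag : ∀ i, IntegrableOn (fun s : ℝ =>
      (NormedSpace.exp (s • A) * W * NormedSpace.exp (s • Aᵀ)) i i) (Ioi 0) := by
    intro i
    by_contra h
    have h1 : 0 < P i i := hpos.diag_pos
    rw [hP, integral_undef h] at h1
    exact lt_irrefl _ h1
  have hcont : Continuous (fun s : ℝ =>
      (NormedSpace.exp (s • A) * W * NormedSpace.exp (s • Aᵀ)) i j) :=
    continuous_iff_continuousAt.2 fun s =>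
      (hasDerivAt_matrix_apply (hasDerivAt_exp_mul_exp A W s) i j).continuousAt
  refine Integrable.mono' ((hdiag i).add (hdiag j)) hcont.aestronglyMeasurable
    (Eventually.of_forall fun s => ?_)
  have hpsd : (NormedSpace.exp (s • A) * W * NormedSpace.exp (s • Aᵀ)).PosSemidef := by
    have := hW.mul_mul_conjTranspose_same (NormedSpace.exp (s • A))
    rwa [Matrix.conjTranspose_eq_transpose_of_trivial, ← Matrix.exp_transpose,
      Matrix.transpose_smul] at this
  exact hpsd.abs_apply_le i j

/-- A positive definite Gramian solves its Lyapunov equation: the integrand and its derivative are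
both integrable, so the integrand vanishes at infinity. -/
lemma lyapunov_of_gramian (hW : W.PosSemidef)
    (hP : ∀ i j, P i j = ∫ s in Ioi (0 : ℝ),
      (NormedSpace.exp (s • A) * W * NormedSpace.exp (s • Aᵀ)) i j)
    (hpos : P.PosDef) : A * P + P * Aᵀ = -W := by
  have hint := integrableOn_gramian hW hP hpos
  have hint1 : ∀ i j, IntegrableOn (fun s : ℝ =>
      (A * (NormedSpace.exp (s • A) * W * NormedSpace.exp (s • Aᵀ))) i j) (Ioi 0) := by
    intro i j
    simp only [Matrix.mul_apply (M := A)]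
    exact integrable_finsetSum _ fun k _ => (hint k j).const_mul _
  have hint2 : ∀ i j, IntegrableOn (fun s : ℝ =>
      (NormedSpace.exp (s • A) * W * NormedSpace.exp (s • Aᵀ) * Aᵀ) i j) (Ioi 0) := by
    intro i j
    simp only [Matrix.mul_apply (N := Aᵀ)]
    exact integrable_finsetSum _ fun k _ => (hint i k).mul_const _
  ext i j
  have hder := fun s : ℝ => hasDerivAt_matrix_apply (hasDerivAt_exp_mul_exp' A W s) i j
  have hlim := tendsto_zero_of_hasDerivAt_of_integrableOn_Ioi (a := 0) (fun s _ => hder s)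
    ((hint1 i j).add (hint2 i j)) (hint i j)
  have hFTC := integral_Ioi_of_hasDerivAt_of_tendsto' (a := 0) (fun s _ => hder s)
    ((hint1 i j).add (hint2 i j)) hlim
  simp only [Matrix.add_apply] at hFTC
  rw [integral_add (hint1 i j) (hint2 i j)] at hFTC
  simp only [zero_smul, NormedSpace.exp_zero, one_mul, mul_one, zero_sub] at hFTC
  rw [Matrix.neg_apply, ← hFTC, Matrix.add_apply]
  congr 1
  · simp only [Matrix.mul_apply (M := A)]
    rw [integral_finsetSum _ fun k _ => (hint k j).const_mul _]
    exact Finset.sum_congr rfl fun k _ => by rw [integral_const_mul, hP]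
  · simp only [Matrix.mul_apply (N := Aᵀ)]
    rw [integral_finsetSum _ fun k _ => (hint i k).mul_const _]
    exact Finset.sum_congr rfl fun k _ => by rw [integral_mul_const, hP]

/-- The quadratic form of a positive definite Gramian decays along the adjoint flow:
`exp(sA) P exp(sAᵀ)` is the tail integral of the Gramian. -/
lemma tendsto_gramian_quadratic (hW : W.PosSemidef)
    (hP : ∀ i j, P i j = ∫ s in Ioi (0 : ℝ),
      (NormedSpace.exp (s • A) * W * NormedSpace.exp (s • Aᵀ)) i j)
    (hpos : P.PosDef) (c : Fin n → ℝ) :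
    Tendsto (fun s : ℝ => (NormedSpace.exp (s • Aᵀ) *ᵥ c) ⬝ᵥ
      (P *ᵥ (NormedSpace.exp (s • Aᵀ) *ᵥ c))) atTop (𝓝 0) := by
  have hint := integrableOn_gramian hW hP hpos
  have hL := lyapunov_of_gramian hW hP hpos
  have hentry : ∀ i j, Tendsto (fun s : ℝ =>
      (NormedSpace.exp (s • A) * P * NormedSpace.exp (s • Aᵀ)) i j) atTop (𝓝 0) := by
    intro i j
    have hder : ∀ s : ℝ, HasDerivAt (fun s : ℝ =>
        (NormedSpace.exp (s • A) * P * NormedSpace.exp (s • Aᵀ)) i j)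
        (-(NormedSpace.exp (s • A) * W * NormedSpace.exp (s • Aᵀ)) i j) s := by
      intro s
      refine (hasDerivAt_matrix_apply (hasDerivAt_exp_mul_exp A P s) i j).congr_deriv ?_
      rw [hL, Matrix.mul_neg, Matrix.neg_mul, Matrix.neg_apply]
    have hcont : Continuous (fun s : ℝ =>
        (NormedSpace.exp (s • A) * W * NormedSpace.exp (s • Aᵀ)) i j) :=
      continuous_iff_continuousAt.2 fun s =>
        (hasDerivAt_matrix_apply (hasDerivAt_exp_mul_exp A W s) i j).continuousAt
    have h1 := intervalIntegral_tendsto_integral_Ioi 0 (hint i j) tendsto_id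
    rw [← hP] at h1
    have h2 := h1.const_sub (P i j)
    rw [sub_self] at h2
    refine h2.congr fun s => ?_
    have h3 := intervalIntegral.integral_eq_sub_of_hasDerivAt (a := 0) (b := s)
      (fun z _ => hder z) (hcont.neg.intervalIntegrable _ _)
    rw [intervalIntegral.integral_neg] at h3
    simp only [zero_smul, NormedSpace.exp_zero, one_mul, mul_one] at h3
    simp only [id]
    linarith
  have hsum : ∀ s : ℝ, (NormedSpace.exp (s • Aᵀ) *ᵥ c) ⬝ᵥ
      (P *ᵥ (NormedSpace.exp (s • Aᵀ) *ᵥ c))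
      = ∑ i, ∑ j, c i * ((NormedSpace.exp (s • A) * P * NormedSpace.exp (s • Aᵀ)) i j * c j) := by
    intro s
    have hE : NormedSpace.exp (s • Aᵀ) = (NormedSpace.exp (s • A))ᵀ := by
      rw [← Matrix.exp_transpose, Matrix.transpose_smul]
    rw [hE, Matrix.mulVec_transpose (NormedSpace.exp (s • A)) c, ← Matrix.dotProduct_mulVec,
      ← Matrix.mulVec_transpose, Matrix.mulVec_mulVec, Matrix.mulVec_mulVec]
    simp only [dotProduct, Matrix.mulVec, Finset.mul_sum, Matrix.mul_assoc]
  simp only [hsum]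
  rw [show (0 : ℝ) = ∑ i : Fin n, ∑ j : Fin n, c i * (0 * c j) by simp]
  exact tendsto_finsetSum _ fun i _ => tendsto_finsetSum _ fun j _ =>
    ((hentry i j).mul_const _).const_mul _

end Gramian

/-! ### The energy of the error kernel -/

section Energy

variable {n r m : ℕ} {A P : Matrix (Fin n) (Fin n) ℝ} {A₁ S : Matrix (Fin r) (Fin r) ℝ}
  {B : Matrix (Fin n) (Fin m) ℝ} {B₁ : Matrix (Fin r) (Fin m) ℝ} {K : Matrix (Fin m) (Fin m) ℝ}
  {G : Matrix (Fin n) (Fin r) ℝ} {u : ℝ → Fin n → ℝ} {v : ℝ → Fin r → ℝ}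

/-- The quadratic form of the block matrix `[P, G; Gᵀ, S]`. -/
def blockQuadratic (P : Matrix (Fin n) (Fin n) ℝ) (G : Matrix (Fin n) (Fin r) ℝ)
    (S : Matrix (Fin r) (Fin r) ℝ) (u : Fin n → ℝ) (v : Fin r → ℝ) : ℝ :=
  u ⬝ᵥ (P *ᵥ u) + 2 * (u ⬝ᵥ (G *ᵥ v)) + v ⬝ᵥ (S *ᵥ v)

lemma hasDerivAt_dotProduct_mulVec {k l : ℕ} {X : Matrix (Fin k) (Fin k) ℝ}
    {Y : Matrix (Fin l) (Fin l) ℝ} {G : Matrix (Fin k) (Fin l) ℝ} {u : ℝ → Fin k → ℝ}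
    {v : ℝ → Fin l → ℝ} {s : ℝ} (hu : HasDerivAt u (Xᵀ *ᵥ u s) s)
    (hv : HasDerivAt v (Yᵀ *ᵥ v s) s) :
    HasDerivAt (fun z => u z ⬝ᵥ (G *ᵥ v z)) (u s ⬝ᵥ ((X * G + G * Yᵀ) *ᵥ v s)) s := by
  have hG : HasDerivAt (fun z => G *ᵥ v z) (G *ᵥ (Yᵀ *ᵥ v s)) s := by
    rw [hasDerivAt_pi]
    intro i
    simp only [Matrix.mulVec, dotProduct] at hv ⊢
    exact HasDerivAt.fun_sum fun j _ => (hasDerivAt_pi.1 hv j).const_mul _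
  refine (hu.dotProduct hG).congr_deriv ?_
  rw [Matrix.mulVec_transpose, ← Matrix.dotProduct_mulVec, Matrix.add_mulVec, dotProduct_add,
    Matrix.mulVec_mulVec, Matrix.mulVec_mulVec]

/-- Along the adjoint flows the block quadratic form loses exactly the energy of the kernel
`Bᵀ u + B₁ᵀ v`. -/
lemma integral_kernel_eq (hK : Kᵀ = K) (hP : A * P + P * Aᵀ = -(B * K * Bᵀ))
    (hG : A * G + G * A₁ᵀ = -(B * K * B₁ᵀ)) (hS : A₁ * S + S * A₁ᵀ = -(B₁ * K * B₁ᵀ))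
    (hu : ∀ s, HasDerivAt u (Aᵀ *ᵥ u s) s) (hv : ∀ s, HasDerivAt v (A₁ᵀ *ᵥ v s) s) (a b : ℝ) :
    ∫ s in a..b, (Bᵀ *ᵥ u s + B₁ᵀ *ᵥ v s) ⬝ᵥ (K *ᵥ (Bᵀ *ᵥ u s + B₁ᵀ *ᵥ v s))
      = blockQuadratic P G S (u a) (v a) - blockQuadratic P G S (u b) (v b) := by
  have huc : Continuous u := continuous_iff_continuousAt.2 fun s => (hu s).continuousAt
  have hvc : Continuous v := continuous_iff_continuousAt.2 fun s => (hv s).continuousAt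
  have hder : ∀ s, HasDerivAt (fun z => -blockQuadratic P G S (u z) (v z))
      ((Bᵀ *ᵥ u s + B₁ᵀ *ᵥ v s) ⬝ᵥ (K *ᵥ (Bᵀ *ᵥ u s + B₁ᵀ *ᵥ v s))) s := by
    intro s
    have h := (((hasDerivAt_dotProduct_mulVec (G := P) (hu s) (hu s)).add
      ((hasDerivAt_dotProduct_mulVec (G := G) (hu s) (hv s)).const_mul 2)).add
      (hasDerivAt_dotProduct_mulVec (G := S) (hv s) (hv s))).neg
    refine h.congr_deriv ?_
    rw [hP, hG, hS]
    have e1 : (B₁ᵀ *ᵥ v s) ⬝ᵥ (K *ᵥ (Bᵀ *ᵥ u s)) = (Bᵀ *ᵥ u s) ⬝ᵥ (K *ᵥ (B₁ᵀ *ᵥ v s)) := by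
      rw [dotProduct_comm, ← Matrix.vecMul_transpose K, hK, ← Matrix.dotProduct_mulVec]
    have e2 : ∀ {k l : ℕ} (X : Matrix (Fin k) (Fin m) ℝ) (Y : Matrix (Fin l) (Fin m) ℝ)
        (a : Fin k → ℝ) (b : Fin l → ℝ),
        a ⬝ᵥ ((-(X * K * Yᵀ)) *ᵥ b) = -((Xᵀ *ᵥ a) ⬝ᵥ (K *ᵥ (Yᵀ *ᵥ b))) := by
      intro k l X Y a b
      rw [Matrix.neg_mulVec, dotProduct_neg, Matrix.mulVec_transpose X, ← Matrix.dotProduct_mulVec,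
        Matrix.mulVec_mulVec, Matrix.mulVec_mulVec, Matrix.mul_assoc]
    rw [e2, e2, e2, Matrix.mulVec_add, add_dotProduct, dotProduct_add, dotProduct_add, e1]
    ring
  have hcont : Continuous fun s =>
      (Bᵀ *ᵥ u s + B₁ᵀ *ᵥ v s) ⬝ᵥ (K *ᵥ (Bᵀ *ᵥ u s + B₁ᵀ *ᵥ v s)) := by
    simp only [dotProduct, Matrix.mulVec, Pi.add_apply]
    fun_prop
  rw [intervalIntegral.integral_eq_sub_of_hasDerivAt (fun s _ => hder s)
    (hcont.intervalIntegrable _ _)]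
  ring

/-- The block matrix `[P, G; Gᵀ, Σ]` of solutions of the Lyapunov equations is positive
semidefinite along the flows. Its quadratic form `V` is nonincreasing, and `V ≥ 2 u ⬝ G v`, where
`u → 0` because `u ⬝ P u → 0` and `v` stays bounded because `v ⬝ Σ v` is nonincreasing. This needs
only boundedness of the flow of `A₁ᵀ`, not its decay. -/
lemma blockQuadratic_nonneg {T : Matrix (Fin n) (Fin n) ℝ} {σ : Fin n → ℝ} {σ₁ : Fin r → ℝ}
    (hK : Kᵀ = K) (hKnn : ∀ z, 0 ≤ z ⬝ᵥ (K *ᵥ z))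
    (hP : A * P + P * Aᵀ = -(B * K * Bᵀ)) (hG : A * G + G * A₁ᵀ = -(B * K * B₁ᵀ))
    (hS : A₁ * Matrix.diagonal σ₁ + Matrix.diagonal σ₁ * A₁ᵀ = -(B₁ * K * B₁ᵀ))
    (hT : IsUnit T.det) (hTP : T * P * Tᵀ = Matrix.diagonal σ) (hσ : ∀ i, 0 < σ i)
    (hσ₁ : ∀ i, 0 < σ₁ i)
    (hu : ∀ s, HasDerivAt u (Aᵀ *ᵥ u s) s) (hv : ∀ s, HasDerivAt v (A₁ᵀ *ᵥ v s) s)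
    (hlim : Tendsto (fun s => u s ⬝ᵥ (P *ᵥ u s)) atTop (𝓝 0)) (a : ℝ) :
    0 ≤ blockQuadratic P G (Matrix.diagonal σ₁) (u a) (v a) := by
  have hdiag : ∀ {k : ℕ} (d : Fin k → ℝ) (z : Fin k → ℝ),
      z ⬝ᵥ (Matrix.diagonal d *ᵥ z) = ∑ i, d i * z i ^ 2 := by
    intro k d z
    simp only [dotProduct, Matrix.mulVec_diagonal]
    exact Finset.sum_congr rfl fun i _ => by ring
  have hterm : ∀ {k : ℕ} (d : Fin k → ℝ) (_ : ∀ i, 0 < d i) (z : Fin k → ℝ) (i : Fin k),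
      d i * z i ^ 2 ≤ z ⬝ᵥ (Matrix.diagonal d *ᵥ z) := by
    intro k d hd z i
    rw [hdiag]
    exact Finset.single_le_sum (f := fun i => d i * z i ^ 2)
      (fun j _ => mul_nonneg (hd j).le (sq_nonneg _)) (Finset.mem_univ i)
  -- `w` holds the coordinates of `u` in which `P` is diagonal
  set w : ℝ → Fin n → ℝ := fun s => (T⁻¹)ᵀ *ᵥ u s with hw
  have huw : ∀ s, u s = Tᵀ *ᵥ w s := by
    intro s
    rw [hw, Matrix.mulVec_mulVec, ← Matrix.transpose_mul, Matrix.nonsing_inv_mul T hT,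
      Matrix.transpose_one, Matrix.one_mulVec]
  have hPw : ∀ s, u s ⬝ᵥ (P *ᵥ u s) = w s ⬝ᵥ (Matrix.diagonal σ *ᵥ w s) := by
    intro s
    rw [← hTP]
    conv_lhs => rw [huw s]
    rw [Matrix.mulVec_transpose, ← Matrix.dotProduct_mulVec, ← Matrix.mulVec_transpose,
      Matrix.mulVec_mulVec, Matrix.mulVec_mulVec, Matrix.mul_assoc]
  have hw0 : ∀ i, Tendsto (fun s => w s i) atTop (𝓝 0) := by
    intro i
    have h1 : Tendsto (fun s => (w s i) ^ 2) atTop (𝓝 0) := by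
      refine squeeze_zero (fun s => sq_nonneg _) (fun s => ?_)
        (by simpa using hlim.const_mul (σ i)⁻¹)
      rw [hPw, ← div_eq_inv_mul, le_div_iff₀ (hσ i), mul_comm]
      exact hterm σ hσ (w s) i
    have h2 := (Real.continuous_sqrt.tendsto 0).comp h1
    rw [Real.sqrt_zero] at h2
    refine (tendsto_zero_iff_abs_tendsto_zero _).2 (h2.congr fun s => ?_)
    simp [Real.sqrt_sq_eq_abs]
  have hvb : ∀ j, ∃ R, ∀ s, a ≤ s → |v s j| ≤ R := by
    intro j
    refine ⟨Real.sqrt ((v a ⬝ᵥ (Matrix.diagonal σ₁ *ᵥ v a)) / σ₁ j), fun s hs => ?_⟩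
    refine Real.abs_le_sqrt ?_
    rw [le_div_iff₀ (hσ₁ j), mul_comm]
    refine (hterm σ₁ hσ₁ (v s) j).trans ?_
    -- the energy identity with `u = 0`
    have h1 := integral_kernel_eq (u := fun _ => 0) hK hP hG hS
      (fun s => by simpa using hasDerivAt_const s (0 : Fin n → ℝ)) hv a s
    have h2 := intervalIntegral.integral_nonneg_of_forall (μ := volume) hs
      (fun s => hKnn (Bᵀ *ᵥ (0 : Fin n → ℝ) + B₁ᵀ *ᵥ v s))
    rw [h1] at h2
    simp only [blockQuadratic, Matrix.mulVec_zero, zero_dotProduct] at h2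
    linarith
  have hcross : Tendsto (fun s => u s ⬝ᵥ (G *ᵥ v s)) atTop (𝓝 0) := by
    have hsum : ∀ s, u s ⬝ᵥ (G *ᵥ v s) = ∑ i, ∑ j, (T * G) i j * (v s j * w s i) := by
      intro s
      rw [huw s, Matrix.mulVec_transpose, ← Matrix.dotProduct_mulVec, Matrix.mulVec_mulVec]
      simp only [dotProduct, Matrix.mulVec, Finset.mul_sum]
      exact Finset.sum_congr rfl fun i _ => Finset.sum_congr rfl fun j _ => by ring
    simp only [hsum]
    rw [show (0 : ℝ) = ∑ i : Fin n, ∑ j : Fin r, (T * G) i j * 0 by simp]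
    refine tendsto_finsetSum _ fun i _ => tendsto_finsetSum _ fun j _ => Tendsto.const_mul _ ?_
    obtain ⟨R, hR⟩ := hvb j
    exact bdd_le_mul_tendsto_zero' R ((eventually_ge_atTop a).mono hR) (hw0 i)
  refine le_of_tendsto (f := fun s => 2 * (u s ⬝ᵥ (G *ᵥ v s))) (x := atTop)
    (by simpa using hcross.const_mul 2) ((eventually_ge_atTop a).mono fun s hs => ?_)
  have h1 := integral_kernel_eq hK hP hG hS hu hv a s
  have h2 := intervalIntegral.integral_nonneg_of_forall (μ := volume) hs
    (fun s => hKnn (Bᵀ *ᵥ u s + B₁ᵀ *ᵥ v s))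
  rw [h1] at h2
  have h3 : 0 ≤ u s ⬝ᵥ (P *ᵥ u s) := by
    rw [hPw, hdiag]
    exact Finset.sum_nonneg fun i _ => mul_nonneg (hσ i).le (sq_nonneg _)
  have h4 : 0 ≤ v s ⬝ᵥ (Matrix.diagonal σ₁ *ᵥ v s) := by
    rw [hdiag]
    exact Finset.sum_nonneg fun i _ => mul_nonneg (hσ₁ i).le (sq_nonneg _)
  simp only [blockQuadratic] at h2 ⊢
  linarith

end Energy

/-! ### The trace formula for the error bound -/

section Trace

variable {n r m p : ℕ}

lemma sum_head_add_sum_tail {E : Type*} [AddCommMonoid E] (h : r ≤ n) (f : Fin n → E) :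
    ∑ i, f i = ∑ i, f (head h i) + ∑ i, f (tail h i) := by
  rw [← Fintype.sum_equiv (finSumFinEquiv.trans (finCongr (Nat.add_sub_of_le h)))
    (Sum.elim (fun i => f (head h i)) (fun i => f (tail h i))) f]
  · simp [Fintype.sum_sum_type]
  · rintro (i | i) <;> simp [head, tail] <;> rfl

lemma mul_eq_head_add_tail {ι κ : Type*} (h : r ≤ n) (X : Matrix ι (Fin n) ℝ)
    (Y : Matrix (Fin n) κ ℝ) :
    X * Y = X.submatrix id (head h) * Y.submatrix (head h) id
      + X.submatrix id (tail h) * Y.submatrix (tail h) id := by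
  ext i j
  simp only [Matrix.mul_apply, Matrix.add_apply, Matrix.submatrix_apply, id]
  exact sum_head_add_sum_tail h _

lemma trace_diagonal_mul_eq (h : r ≤ n) (σ : Fin n → ℝ) (X : Matrix (Fin n) (Fin n) ℝ) :
    (Matrix.diagonal σ * X).trace
      = (Matrix.diagonal (fun i => σ (head h i)) * X.submatrix (head h) (head h)).trace
        + (sigma2 h σ * X.submatrix (tail h) (tail h)).trace := by
  simp only [Matrix.trace, Matrix.diag_apply, sigma2, Matrix.diagonal_mul, Matrix.submatrix_apply]
  exact sum_head_add_sum_tail h _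

/-- Two Lyapunov equations with the same solution `D` give the same squared `H₂` norm. -/
lemma trace_mul_eq_of_lyapunov {k : ℕ} {A D W N : Matrix (Fin k) (Fin k) ℝ}
    (hW : A * D + D * Aᵀ = -W) (hN : Aᵀ * D + D * A = -N) : (N * D).trace = (D * W).trace := by
  rw [← neg_eq_iff_eq_neg.2 hW, ← neg_eq_iff_eq_neg.2 hN]
  rw [Matrix.neg_mul, Matrix.mul_neg, Matrix.trace_neg, Matrix.trace_neg, Matrix.add_mul,
    Matrix.mul_add, Matrix.trace_add, Matrix.trace_add, Matrix.mul_assoc, Matrix.mul_assoc,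
    Matrix.trace_mul_comm Aᵀ, ← Matrix.mul_assoc D D, add_comm]

/-- The leading block of a Lyapunov equation with diagonal solution. -/
lemma lyapunov_head (h : r ≤ n) {A W : Matrix (Fin n) (Fin n) ℝ} {σ : Fin n → ℝ}
    (hA : A * Matrix.diagonal σ + Matrix.diagonal σ * Aᵀ = -W) :
    A.submatrix (head h) (head h) * Matrix.diagonal (fun i => σ (head h i))
      + Matrix.diagonal (fun i => σ (head h i)) * (A.submatrix (head h) (head h))ᵀ
      = -W.submatrix (head h) (head h) := by
  ext i j
  have := congrFun (congrFun hA (head h i)) (head h j)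
  simpa [Matrix.mul_diagonal, Matrix.diagonal_mul] using this

/-- For a balanced realisation `(A, B, C)` with Gramian `Σ = diag(σ)`, the squared error
`tr(C Σ Cᵀ) - 2 tr(C G C₁ᵀ) + tr(C₁ Σ₁ C₁ᵀ)` depends only on the truncated singular values. -/
lemma balanced_trace_identity (h : r ≤ n) {A : Matrix (Fin n) (Fin n) ℝ}
    {B : Matrix (Fin n) (Fin m) ℝ} {C : Matrix (Fin p) (Fin n) ℝ} {K : Matrix (Fin m) (Fin m) ℝ}
    {σ : Fin n → ℝ} {G : Matrix (Fin n) (Fin r) ℝ}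
    (hP : A * Matrix.diagonal σ + Matrix.diagonal σ * Aᵀ = -(B * K * Bᵀ))
    (hQ : Aᵀ * Matrix.diagonal σ + Matrix.diagonal σ * A = -(Cᵀ * C))
    (hG : A * G + G * (A.submatrix (head h) (head h))ᵀ = -(B * K * (topRows h B)ᵀ)) :
    (C * Matrix.diagonal σ * Cᵀ).trace
        - 2 * (C * G * (C.submatrix id (head h))ᵀ).trace
        + (C.submatrix id (head h) * Matrix.diagonal (fun i => σ (head h i))
            * (C.submatrix id (head h))ᵀ).trace
      = (sigma2 h σ * (bottomRows h B * K * (bottomRows h B)ᵀ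
          + (2 : ℝ) • (bottomRows h G * (A.submatrix (tail h) (head h))ᵀ))).trace := by
  set A₁₁ := A.submatrix (head h) (head h) with hA11
  set A₁₂ := A.submatrix (head h) (tail h) with hA12
  set A₂₁ := A.submatrix (tail h) (head h) with hA21
  set C₁ := C.submatrix id (head h) with hC1
  set C₂ := C.submatrix id (tail h) with hC2
  set D₁ := Matrix.diagonal fun i => σ (head h i) with hD1
  set D₂ := sigma2 h σ with hD2
  set W₁ := topRows h B * K * (topRows h B)ᵀ with hW1
  set W₂ := bottomRows h B * K * (bottomRows h B)ᵀ with hW2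
  -- block equations
  have eP : A₁₁ * D₁ + D₁ * A₁₁ᵀ = -W₁ := lyapunov_head h hP
  have eQ1 : A₁₁ᵀ * D₁ + D₁ * A₁₁ = -(C₁ᵀ * C₁) := by
    have h1 := lyapunov_head h (A := Aᵀ) (by rwa [Matrix.transpose_transpose])
    exact h1
  have eQ2 : A₂₁ᵀ * D₂ + D₁ * A₁₂ = -(C₁ᵀ * C₂) := by
    have hN : C₁ᵀ * C₂ = (Cᵀ * C).submatrix (head h) (tail h) := rfl
    rw [hN]
    ext i j
    have := congrFun (congrFun hQ (head h i)) (tail h j)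
    simpa [Matrix.mul_diagonal, Matrix.diagonal_mul, hD1, hD2, hA12, hA21, sigma2] using this
  have eG : A₁₁ * topRows h G + A₁₂ * bottomRows h G + topRows h G * A₁₁ᵀ = -W₁ := by
    have h1 := congrArg (fun X => X.submatrix (head h) id) hG
    rw [mul_eq_head_add_tail h A G] at h1
    exact h1
  have t1 : (C * Matrix.diagonal σ * Cᵀ).trace = (D₁ * W₁).trace + (D₂ * W₂).trace := by
    rw [Matrix.trace_mul_cycle, trace_mul_eq_of_lyapunov hP hQ, trace_diagonal_mul_eq h]
    rfl
  have t2 : (C₁ * D₁ * C₁ᵀ).trace = (D₁ * W₁).trace := by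
    rw [Matrix.trace_mul_cycle, trace_mul_eq_of_lyapunov eP eQ1]
  have t3 : (C * G * C₁ᵀ).trace
      = (D₁ * W₁).trace - (D₂ * (bottomRows h G * A₂₁ᵀ)).trace := by
    have hCG : C * G = C₁ * topRows h G + C₂ * bottomRows h G := mul_eq_head_add_tail h C G
    have h1 : C₁ᵀ * (C * G) = D₁ * W₁ + (D₁ * (topRows h G * A₁₁ᵀ) - A₁₁ᵀ * (D₁ * topRows h G))
        - A₂₁ᵀ * (D₂ * bottomRows h G) := by
      rw [hCG, Matrix.mul_add, ← Matrix.mul_assoc, ← Matrix.mul_assoc, ← neg_eq_iff_eq_neg.2 eQ1,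
        ← neg_eq_iff_eq_neg.2 eQ2, ← neg_eq_iff_eq_neg.2 eG]
      simp only [Matrix.neg_mul, Matrix.mul_neg, Matrix.add_mul, Matrix.mul_add, Matrix.mul_assoc]
      abel
    rw [Matrix.trace_mul_comm, h1, Matrix.trace_sub, Matrix.trace_add, Matrix.trace_sub,
      Matrix.trace_mul_comm A₁₁ᵀ, Matrix.trace_mul_comm A₂₁ᵀ, Matrix.mul_assoc, Matrix.mul_assoc,
      sub_self, add_zero]
  rw [t1, t2, t3, Matrix.mul_add, Matrix.trace_add, Matrix.mul_smul, Matrix.trace_smul,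
    smul_eq_mul]
  ring

end Trace

/-! ### The error of the reduced system -/

section Error

variable {Ω : Type*} [MeasurableSpace Ω] {μ : Measure Ω} {n m p r : ℕ}
  {M : ℝ≥0 → Ω → Fin m → ℝ}

/-- A functional `c ⬝ x(t) + c₁ ⬝ x_r(t)` of two solutions driven by the same noise is the Wiener
integral of the kernel `Bᵀ u + B₁ᵀ v`, where `u` and `v` solve the adjoint equations. -/
lemma dotProduct_add_dotProduct_eq {A : Matrix (Fin n) (Fin n) ℝ} {B : Matrix (Fin n) (Fin m) ℝ}
    {A₁ : Matrix (Fin r) (Fin r) ℝ} {B₁ : Matrix (Fin r) (Fin m) ℝ}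
    {x : ℝ≥0 → Ω → Fin n → ℝ} {xr : ℝ≥0 → Ω → Fin r → ℝ}
    (hM : ∀ᵐ ω ∂μ, IsCadlag (fun t => M t ω)) (hx : IsSolution A B M μ x)
    (hxr : IsSolution A₁ B₁ M μ xr) {u : ℝ → Fin n → ℝ} {v : ℝ → Fin r → ℝ}
    (hu : ∀ s, HasDerivAt u (Aᵀ *ᵥ u s) s) (hv : ∀ s, HasDerivAt v (A₁ᵀ *ᵥ v s) s) (t : ℝ≥0) :
    ∀ᵐ ω ∂μ, u 0 ⬝ᵥ x t ω + v 0 ⬝ᵥ xr t ω = (Bᵀ *ᵥ u 0 + B₁ᵀ *ᵥ v 0) ⬝ᵥ M t ω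
      + ∫ s in (0 : ℝ)..t, (Bᵀ *ᵥ (Aᵀ *ᵥ u (t - s)) + B₁ᵀ *ᵥ (A₁ᵀ *ᵥ v (t - s))) ⬝ᵥ
          M s.toNNReal ω := by
  filter_upwards [hM, hx.cadlag, hx.equation, hxr.cadlag, hxr.equation] with ω h h1 h2 h3 h4
  have huc : Continuous u := continuous_iff_continuousAt.2 fun s => (hu s).continuousAt
  have hvc : Continuous v := continuous_iff_continuousAt.2 fun s => (hv s).continuousAt
  have hint : ∀ ψ : ℝ → Fin m → ℝ, Continuous ψ →
      IntervalIntegrable (fun s : ℝ => ψ s ⬝ᵥ M s.toNNReal ω) volume 0 t := by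
    intro ψ hψ
    exact (IntervalIntegrable.sum Finset.univ (f := fun i s => ψ s i * M s.toNNReal ω i)
      fun i _ => (h.comp_continuous (continuous_apply i)).intervalIntegrable_mul
        (by fun_prop) t).congr fun s _ => by simp [Finset.sum_apply, dotProduct]
  rw [dotProduct_eq_of_integral_equation h1
      (h.comp_continuous (g := fun z => B *ᵥ z) (by fun_prop)) h2 hu t,
    dotProduct_eq_of_integral_equation h3
      (h.comp_continuous (g := fun z => B₁ *ᵥ z) (by fun_prop)) h4 hv t]
  simp only [add_dotProduct]
  rw [intervalIntegral.integral_add (hint _ (by fun_prop)) (hint _ (by fun_prop))]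
  simp only [Matrix.mulVec_transpose B, Matrix.mulVec_transpose B₁, ← Matrix.dotProduct_mulVec]
  ring

variable [IsProbabilityMeasure μ]

/-- The second moment of `c ⬝ x(t) + c₁ ⬝ x_r(t)` is at most the block quadratic form of the
Lyapunov solutions at `(c, c₁)`. -/
lemma lintegral_dotProduct_sq_le (hM : IsSqIntegrableCenteredLevy M μ)
    {A P T : Matrix (Fin n) (Fin n) ℝ} {B : Matrix (Fin n) (Fin m) ℝ}
    {A₁ : Matrix (Fin r) (Fin r) ℝ} {B₁ : Matrix (Fin r) (Fin m) ℝ} {G : Matrix (Fin n) (Fin r) ℝ}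
    {σ : Fin n → ℝ} {σ₁ : Fin r → ℝ}
    {x : ℝ≥0 → Ω → Fin n → ℝ} {xr : ℝ≥0 → Ω → Fin r → ℝ}
    (hx : IsSolution A B M μ x) (hxr : IsSolution A₁ B₁ M μ xr)
    (hP : A * P + P * Aᵀ = -(B * covMatrix M μ * Bᵀ))
    (hG : A * G + G * A₁ᵀ = -(B * covMatrix M μ * B₁ᵀ))
    (hS : A₁ * Matrix.diagonal σ₁ + Matrix.diagonal σ₁ * A₁ᵀ = -(B₁ * covMatrix M μ * B₁ᵀ))
    (hT : IsUnit T.det) (hTP : T * P * Tᵀ = Matrix.diagonal σ) (hσ : ∀ i, 0 < σ i)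
    (hσ₁ : ∀ i, 0 < σ₁ i)
    (hlim : ∀ c : Fin n → ℝ, Tendsto (fun s : ℝ => (NormedSpace.exp (s • Aᵀ) *ᵥ c) ⬝ᵥ
      (P *ᵥ (NormedSpace.exp (s • Aᵀ) *ᵥ c))) atTop (𝓝 0))
    (c : Fin n → ℝ) (c₁ : Fin r → ℝ) (t : ℝ≥0) :
    0 ≤ blockQuadratic P G (Matrix.diagonal σ₁) c c₁ ∧
    ∫⁻ ω, ENNReal.ofReal ((c ⬝ᵥ x t ω + c₁ ⬝ᵥ xr t ω) ^ 2) ∂μ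
      ≤ ENNReal.ofReal (blockQuadratic P G (Matrix.diagonal σ₁) c c₁) := by
  set u : ℝ → Fin n → ℝ := fun s => NormedSpace.exp (s • Aᵀ) *ᵥ c with hu_def
  set v : ℝ → Fin r → ℝ := fun s => NormedSpace.exp (s • A₁ᵀ) *ᵥ c₁ with hv_def
  have hu : ∀ s, HasDerivAt u (Aᵀ *ᵥ u s) s := hasDerivAt_exp_smul_mulVec Aᵀ c
  have hv : ∀ s, HasDerivAt v (A₁ᵀ *ᵥ v s) s := hasDerivAt_exp_smul_mulVec A₁ᵀ c₁
  have huc : Continuous u := continuous_iff_continuousAt.2 fun s => (hu s).continuousAt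
  have hvc : Continuous v := continuous_iff_continuousAt.2 fun s => (hv s).continuousAt
  have hu0 : u 0 = c := by simp [hu_def]
  have hv0 : v 0 = c₁ := by simp [hv_def]
  have hnn := blockQuadratic_nonneg covMatrix_transpose hM.covMatrix_quadratic_nonneg hP hG hS hT
    hTP hσ hσ₁ hu hv (hlim c)
  refine ⟨by simpa [hu0, hv0] using hnn 0, ?_⟩
  have hmul : ∀ {k : ℕ} (X : Matrix (Fin k) (Fin m) ℝ) (Y : Matrix (Fin k) (Fin k) ℝ)
      (z : ℝ → Fin k → ℝ), (∀ s, HasDerivAt z (Y *ᵥ z s) s) →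
      ∀ s, HasDerivAt (fun s => Xᵀ *ᵥ z s) (Xᵀ *ᵥ (Y *ᵥ z s)) s := by
    intro k X Y z hz s
    exact (Matrix.mulVecLin Xᵀ).toContinuousLinearMap.hasFDerivAt.comp_hasDerivAt s (hz s)
  have hbound := hM.lintegral_convolution_sq_le
    (φ := fun s => Bᵀ *ᵥ u s + B₁ᵀ *ᵥ v s)
    (fun s => (hmul B Aᵀ u hu s).add (hmul B₁ A₁ᵀ v hv s)) (by fun_prop) t
  rw [integral_kernel_eq covMatrix_transpose hP hG hS hu hv, hu0, hv0] at hbound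
  calc ∫⁻ ω, ENNReal.ofReal ((c ⬝ᵥ x t ω + c₁ ⬝ᵥ xr t ω) ^ 2) ∂μ
      = _ := by
        refine lintegral_congr_ae ?_
        filter_upwards [dotProduct_add_dotProduct_eq hM.cadlag hx hxr hu hv t] with ω hω
        rw [hu0, hv0] at hω
        rw [hω]
    _ ≤ _ := hbound
    _ ≤ _ := ENNReal.ofReal_le_ofReal (by linarith [hnn t])

/-- The sum of the block quadratic forms over the rows of `(C, -C₁)`. -/
lemma sum_blockQuadratic_rows (P : Matrix (Fin n) (Fin n) ℝ) (G : Matrix (Fin n) (Fin r) ℝ)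
    (S : Matrix (Fin r) (Fin r) ℝ) (C : Matrix (Fin p) (Fin n) ℝ) (C₁ : Matrix (Fin p) (Fin r) ℝ) :
    ∑ k, blockQuadratic P G S (C k) (-C₁ k)
      = (C * P * Cᵀ).trace - 2 * (C * G * C₁ᵀ).trace + (C₁ * S * C₁ᵀ).trace := by
  have key : ∀ {a b : ℕ} (X : Matrix (Fin p) (Fin a) ℝ) (Y : Matrix (Fin p) (Fin b) ℝ)
      (N : Matrix (Fin a) (Fin b) ℝ), (X * N * Yᵀ).trace = ∑ k, X k ⬝ᵥ (N *ᵥ Y k) := by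
    intro a b X Y N
    rw [Matrix.mul_assoc]
    rfl
  simp only [key, blockQuadratic, Finset.sum_add_distrib, Matrix.mulVec_neg, dotProduct_neg,
    neg_dotProduct, neg_neg, ← Finset.mul_sum, Finset.sum_neg_distrib]
  ring

/-- A random vector of `ℝᵖ` with componentwise bounded second moments is integrable, and its first
absolute moment is bounded by the Cauchy–Schwarz inequality. -/
lemma integrable_and_lintegral_enorm_le {e : Ω → EuclideanSpace ℝ (Fin p)}
    (he : AEMeasurable e μ) {V : Fin p → ℝ} (hV : ∀ k, 0 ≤ V k)
    (hle : ∀ k, ∫⁻ ω, ENNReal.ofReal ((e ω k) ^ 2) ∂μ ≤ ENNReal.ofReal (V k)) :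
    Integrable e μ ∧ ∫⁻ ω, ‖e ω‖ₑ ∂μ ≤ ENNReal.ofReal (Real.sqrt (∑ k, V k)) := by
  have hsq : ∫⁻ ω, ‖e ω‖ₑ ^ (2 : ℝ) ∂μ ≤ ENNReal.ofReal (∑ k, V k) := by
    have h1 : ∀ ω, ‖e ω‖ₑ ^ (2 : ℝ) = ∑ k, ENNReal.ofReal ((e ω k) ^ 2) := by
      intro ω
      rw [← ENNReal.ofReal_sum_of_nonneg fun k _ => sq_nonneg _, ← ofReal_norm,
        ENNReal.ofReal_rpow_of_nonneg (norm_nonneg _) (by norm_num), Real.rpow_two,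
        EuclideanSpace.norm_sq_eq]
      simp
    simp only [h1]
    have hm : ∀ k, AEMeasurable (fun ω => ENNReal.ofReal ((e ω k) ^ 2)) μ := fun k =>
      ((((EuclideanSpace.proj k : EuclideanSpace ℝ (Fin p) →L[ℝ] ℝ).measurable).comp_aemeasurable
        he).pow_const 2).ennreal_ofReal
    rw [lintegral_finsetSum' _ fun k _ => hm k, ENNReal.ofReal_sum_of_nonneg fun k _ => hV k]
    exact Finset.sum_le_sum fun k _ => hle k
  have h2 : eLpNorm e 2 μ ≤ ENNReal.ofReal (Real.sqrt (∑ k, V k)) := by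
    rw [eLpNorm_eq_lintegral_rpow_enorm_toReal (by norm_num) (by norm_num), Real.sqrt_eq_rpow,
      ← ENNReal.ofReal_rpow_of_nonneg (Finset.sum_nonneg fun k _ => hV k) (by norm_num)]
    exact ENNReal.rpow_le_rpow hsq (by norm_num)
  have hLp : MemLp e 2 μ := ⟨he.aestronglyMeasurable, h2.trans_lt ENNReal.ofReal_lt_top⟩
  refine ⟨hLp.integrable (by norm_num), ?_⟩
  rw [← eLpNorm_one_eq_lintegral_enorm]
  exact (eLpNorm_le_eLpNorm_of_exponent_le (by norm_num) he.aestronglyMeasurable).trans h2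

end Error

/-! ### Balancing -/

section Balancing

variable {n r m p : ℕ}

lemma lyapunov_balanced {A P T D : Matrix (Fin n) (Fin n) ℝ} {B : Matrix (Fin n) (Fin m) ℝ}
    {K : Matrix (Fin m) (Fin m) ℝ} (hT : IsUnit T.det) (hD : T * P * Tᵀ = D)
    (hP : A * P + P * Aᵀ = -(B * K * Bᵀ)) :
    T * A * T⁻¹ * D + D * (T * A * T⁻¹)ᵀ = -(T * B * K * (T * B)ᵀ) := by
  have h1 : T⁻¹ * (T * (P * Tᵀ)) = P * Tᵀ := Matrix.nonsing_inv_mul_cancel_left _ _ hT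
  have h2 : Tᵀ * ((T⁻¹)ᵀ * (Aᵀ * Tᵀ)) = Aᵀ * Tᵀ := by
    rw [← Matrix.mul_assoc, ← Matrix.transpose_mul, Matrix.nonsing_inv_mul T hT,
      Matrix.transpose_one, Matrix.one_mul]
  have h3 : T * (A * P + P * Aᵀ) * Tᵀ = -(T * B * K * (T * B)ᵀ) := by
    rw [hP, Matrix.transpose_mul]
    simp only [Matrix.mul_neg, Matrix.neg_mul, Matrix.mul_assoc]
  rw [← h3, ← hD]
  simp only [Matrix.transpose_mul, Matrix.mul_assoc, Matrix.mul_add, Matrix.add_mul, h1, h2]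

lemma lyapunov_balanced_adjoint {A Q T D : Matrix (Fin n) (Fin n) ℝ}
    {C : Matrix (Fin p) (Fin n) ℝ} (hT : IsUnit T.det) (hD : (T⁻¹)ᵀ * Q * T⁻¹ = D)
    (hQ : Aᵀ * Q + Q * A = -(Cᵀ * C)) :
    (T * A * T⁻¹)ᵀ * D + D * (T * A * T⁻¹) = -((C * T⁻¹)ᵀ * (C * T⁻¹)) := by
  have h1 : ∀ X : Matrix (Fin n) (Fin n) ℝ, T⁻¹ * (T * X) = X := fun X =>
    Matrix.nonsing_inv_mul_cancel_left _ _ hT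
  have h2 : ∀ X : Matrix (Fin n) (Fin n) ℝ, Tᵀ * ((T⁻¹)ᵀ * X) = X := fun X => by
    rw [← Matrix.mul_assoc, ← Matrix.transpose_mul, Matrix.nonsing_inv_mul T hT,
      Matrix.transpose_one, Matrix.one_mul]
  have h3 : (T⁻¹)ᵀ * (Aᵀ * Q + Q * A) * T⁻¹ = -((C * T⁻¹)ᵀ * (C * T⁻¹)) := by
    rw [hQ, Matrix.transpose_mul]
    simp only [Matrix.mul_neg, Matrix.neg_mul, Matrix.mul_assoc]
  rw [← h3, ← hD]
  simp only [Matrix.transpose_mul, Matrix.mul_assoc, Matrix.mul_add, Matrix.add_mul, h1, h2]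

/-- The block quadratic forms of the output rows add up to the squared error bound. -/
lemma sum_blockQuadratic_eq_errorBoundSq (h : r ≤ n) {A P Q T : Matrix (Fin n) (Fin n) ℝ}
    {B : Matrix (Fin n) (Fin m) ℝ} {C : Matrix (Fin p) (Fin n) ℝ} {K : Matrix (Fin m) (Fin m) ℝ}
    {σ : Fin n → ℝ} {G : Matrix (Fin n) (Fin r) ℝ} (hT : IsBalancing P Q T σ)
    (hP : A * P + P * Aᵀ = -(B * K * Bᵀ)) (hQ : Aᵀ * Q + Q * A = -(Cᵀ * C))
    (hG : A * G + G * (blockA11 h T A)ᵀ = -(B * K * (topRows h (T * B))ᵀ)) :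
    ∑ k, blockQuadratic P G (Matrix.diagonal fun i => σ (head h i)) (C k) (-blockC1 h T C k)
      = errorBoundSq h A T B K σ G := by
  have h1 : ∀ {k : ℕ} (X : Matrix (Fin n) (Fin k) ℝ), T⁻¹ * (T * X) = X := fun X =>
    Matrix.nonsing_inv_mul_cancel_left _ _ hT.nonsingular
  have h2 : ∀ {k : ℕ} (X : Matrix (Fin n) (Fin k) ℝ), Tᵀ * ((T⁻¹)ᵀ * X) = X := fun X => by
    rw [← Matrix.mul_assoc, ← Matrix.transpose_mul, Matrix.nonsing_inv_mul T hT.nonsingular,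
      Matrix.transpose_one, Matrix.one_mul]
  have hG' : T * A * T⁻¹ * (T * G) + T * G * ((T * A * T⁻¹).submatrix (head h) (head h))ᵀ
      = -(T * B * K * (topRows h (T * B))ᵀ) := by
    change T * A * T⁻¹ * (T * G) + T * G * (blockA11 h T A)ᵀ = _
    have h3 := congrArg (fun X => T * X) hG
    simp only [Matrix.mul_add, Matrix.mul_neg] at h3
    simp only [Matrix.mul_assoc, h1] at h3 ⊢
    exact h3
  have hid := balanced_trace_identity h (C := C * T⁻¹)
    (lyapunov_balanced hT.nonsingular hT.reach hP)
    (lyapunov_balanced_adjoint hT.nonsingular hT.obs hQ) hG'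
  have e1 : C * T⁻¹ * Matrix.diagonal σ * (C * T⁻¹)ᵀ = C * P * Cᵀ := by
    rw [← hT.reach, Matrix.transpose_mul]
    simp only [Matrix.mul_assoc, h1, h2]
  have e2 : C * T⁻¹ * (T * G) = C * G := by rw [Matrix.mul_assoc, h1]
  rw [e1, e2] at hid
  exact (sum_blockQuadratic_rows P G _ C (blockC1 h T C)).trans hid

end Balancing

end LevyBT

theorem theorem2p10 {Ω : Type*} [MeasurableSpace Ω] (μ : Measure Ω) [IsProbabilityMeasure μ]
    {n m p r : ℕ} (hr : 0 < r) (hrn : r < n)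
    -- the system, its noise and the Gramians
    (A : Matrix (Fin n) (Fin n) ℝ) (B : Matrix (Fin n) (Fin m) ℝ)
    (C : Matrix (Fin p) (Fin n) ℝ) (hA : LevyBT.IsAsympStable A)
    (M : ℝ≥0 → Ω → Fin m → ℝ) (hM : LevyBT.IsSqIntegrableCenteredLevy M μ)
    (hP : (LevyBT.reachabilityGramian A B (LevyBT.covMatrix M μ)).PosDef)
    (hQ : (LevyBT.observabilityGramian A C).PosDef)
    -- Hankel singular values and a balancing transformation
    (σ : Fin n → ℝ)
    (hσ : LevyBT.IsHankelSingularValues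
      (LevyBT.reachabilityGramian A B (LevyBT.covMatrix M μ))
      (LevyBT.observabilityGramian A C) σ)
    (hσr : σ ⟨r - 1, by omega⟩ ≠ σ ⟨r, hrn⟩)
    (T : Matrix (Fin n) (Fin n) ℝ)
    (hT : LevyBT.IsBalancing
      (LevyBT.reachabilityGramian A B (LevyBT.covMatrix M μ))
      (LevyBT.observabilityGramian A C) T σ)
    -- the solution of the mixed Lyapunov equation, with `A_r = A₁₁` and `B_r = B₁`
    (Pg : Matrix (Fin n) (Fin r) ℝ)
    (hPg : A * Pg + Pg * (LevyBT.blockA11 hrn.le T A)ᵀ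
      = -(B * LevyBT.covMatrix M μ * (LevyBT.topRows hrn.le (T * B))ᵀ))
    -- the states of the full and of the reduced system
    (x : ℝ≥0 → Ω → Fin n → ℝ) (hx : LevyBT.IsSolution A B M μ x)
    (xr : ℝ≥0 → Ω → Fin r → ℝ)
    (hxr : LevyBT.IsSolution (LevyBT.blockA11 hrn.le T A) (LevyBT.topRows hrn.le (T * B)) M μ xr)
    (tmax : ℝ≥0) :
    (∀ t ∈ Set.Icc 0 tmax, Integrable
      (fun ω => LevyBT.output C x t ω - LevyBT.output (LevyBT.blockC1 hrn.le T C) xr t ω) μ) ∧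
    0 ≤ LevyBT.errorBoundSq hrn.le A T B (LevyBT.covMatrix M μ) σ Pg ∧
    (⨆ t ∈ Set.Icc 0 tmax, ∫⁻ ω,
        ‖LevyBT.output C x t ω - LevyBT.output (LevyBT.blockC1 hrn.le T C) xr t ω‖ₑ ∂μ)
      ≤ ENNReal.ofReal
          (Real.sqrt (LevyBT.errorBoundSq hrn.le A T B (LevyBT.covMatrix M μ) σ Pg)) := by
  set K := LevyBT.covMatrix M μ with hK
  set P := LevyBT.reachabilityGramian A B K with hPdef
  set Q := LevyBT.observabilityGramian A C with hQdef
  have hKpsd : K.PosSemidef := Matrix.PosSemidef.of_dotProduct_mulVec_nonneg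
    (by rw [Matrix.IsHermitian, Matrix.conjTranspose_eq_transpose_of_trivial]
        exact LevyBT.covMatrix_transpose)
    (fun z => by simpa using hM.covMatrix_quadratic_nonneg z)
  have hWpsd : (B * K * Bᵀ).PosSemidef := by
    simpa using hKpsd.mul_mul_conjTranspose_same B
  have hNpsd : (Cᵀ * C).PosSemidef := by
    simpa using Matrix.posSemidef_conjTranspose_mul_self C
  have hPint : ∀ i j, P i j = ∫ s in Ioi (0 : ℝ),
      (NormedSpace.exp (s • A) * (B * K * Bᵀ) * NormedSpace.exp (s • Aᵀ)) i j := fun _ _ => rfl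
  have hPL := LevyBT.lyapunov_of_gramian hWpsd hPint hP
  have hQL : Aᵀ * Q + Q * A = -(Cᵀ * C) := by
    have h := LevyBT.lyapunov_of_gramian (A := Aᵀ) (P := Q) hNpsd (fun i j => by
      rw [Matrix.transpose_transpose]; rfl) hQ
    rwa [Matrix.transpose_transpose] at h
  have hσpos : ∀ i, 0 < σ i := by
    have h : (Matrix.diagonal σ).PosDef := by
      rw [← hT.reach]
      have hTinj : Function.Injective T.vecMul :=
        Matrix.vecMul_injective_iff_isUnit.2 ((Matrix.isUnit_iff_isUnit_det T).2 hT.nonsingular)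
      simpa using hP.mul_mul_conjTranspose_same hTinj
    exact Matrix.posDef_diagonal_iff.1 h
  -- the leading block of the balanced equation, solved by `Σ₁`
  have hS := LevyBT.lyapunov_head hrn.le (LevyBT.lyapunov_balanced hT.nonsingular hT.reach hPL)
  have key := fun (k : Fin p) (t : ℝ≥0) => LevyBT.lintegral_dotProduct_sq_le hM hx hxr hPL hPg hS
    hT.nonsingular hT.reach hσpos (fun i => hσpos _)
    (LevyBT.tendsto_gramian_quadratic hWpsd hPint hP) (C k) (-LevyBT.blockC1 hrn.le T C k) t
  have hsum := LevyBT.sum_blockQuadratic_eq_errorBoundSq hrn.le hT hPL hQL hPg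
  have herr := fun t : ℝ≥0 => LevyBT.integrable_and_lintegral_enorm_le
    (e := fun ω => LevyBT.output C x t ω - LevyBT.output (LevyBT.blockC1 hrn.le T C) xr t ω)
    (by
      have h1 : ∀ {k : ℕ} (X : Matrix (Fin p) (Fin k) ℝ), Measurable fun z : Fin k → ℝ =>
          (WithLp.toLp 2 (X *ᵥ z) : EuclideanSpace ℝ (Fin p)) := fun X =>
        Continuous.measurable (by fun_prop)
      exact ((h1 C).comp_aemeasurable (hx.aemeasurable t)).sub
        ((h1 _).comp_aemeasurable (hxr.aemeasurable t)))
    (fun k => (key k t).1) (fun k => by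
      refine le_trans (le_of_eq ?_) (key k t).2
      refine lintegral_congr fun ω => ?_
      rw [neg_dotProduct, ← sub_eq_add_neg]
      rfl)
  rw [hsum] at herr
  refine ⟨fun t _ => (herr t).1, ?_, iSup₂_le fun t _ => (herr t).2⟩
  rw [← hsum]
  exact Finset.sum_nonneg fun k _ => (key k 0).1
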